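/- Let $\mathcal X=(\Omega,\{R_0,\dots,R_7\})$ be a commutative association scheme with $7$ classes on a finite set $\Omega$, with adjacency matrices $A_0,\dots,A_7$. Suppose that, for some ordering $E_0,\dots,E_7$ of the primitive idempotents of its Bose--Mesner algebra $\mathrm{span}_{\mathbb C}(A_0,\dots,A_7)$, one has $(A_0,\dots,A_7)=(E_0,\dots,E_7)P$, where $$P=\begin{bmatrix} 1 & 1 & 1 & 1 & 63 & 63 & 63 & 63\\ 1 & i & -1 & -i & 21 & 21i & -21 & -21i\\ 1 & -1 & 1 & -1 & -9 & 9 & -9 & 9\\ 1 & -i & -1 & i & 21 & -21i & -21 & 21i\\ 1 & 1 & 1 & 1 & -1 & -1 & -1 & -1\\ 1 & i & -1 & -i & -3 & -3i & 3 & 3i\\ 1 & -1 & 1 & -1 & 7 & -7 & 7 & -7\\ 1 & -i & -1 & i & -3 & 3i & 3 & -3i \end{bmatrix}$$ (that is, $\mathcal X$ has eigenmatrix $P$). Then: 1. $\mathcal X$ is triply regular: for all $u,v,w\in\Omega$ and $i,j,k\in\{0,\dots,7\}$, the number of $x\in\Omega$ with $(u,x)\in R_i$, $(v,x)\in R_j$,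 $(w,x)\in R_k$ depends only on $i,j,k$ and on the relations containing $(u,v)$, $(u,w)$ and $(v,w)$. 2. Let $z\in\Omega$ and let $R_i$ be a thick relation, i.e. one of valency different from $1$. Put $R_i(z)=\{x\in\Omega : (z,x)\in R_i\}$ and $R_j'=R_j\cap (R_i(z)\times R_i(z))$. Then $(R_i(z),\{R_j' : R_j'\neq\varnothing\})$, the local scheme at $z$ with respect to $R_i$, is a commutative association scheme with $4$ classes and, for a suitable ordering of its relations and of its primitive idempotents, it has eigenmatrix $$\begin{bmatrix} 1&6&16&24&16\\ 1&3&-2&0&-2\\ 1&-1&2&-4&2\\ 1&-3&-2+6i&6&-2-6i\\ 1&-3&-2-6i&6&-2+6i \end{bmatrix}.$$ -/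

import Mathlib

/-- A commutative association scheme with `d` classes on the finite set `Ω`: relations
`R_0, …, R_d` that partition `Ω × Ω` (with nonempty parts), `R_0` being the identity relation,
closed under transposition, with intersection numbers `p i j k` satisfying
`p i j k = p j i k`. (The numbers `p i j k` are determined by the relations.) -/
structure AssociationScheme (d : ℕ) (Ω : Type*) [Fintype Ω] where
  /-- The relations `R_0, …, R_d`. -/
  rel : Fin (d + 1) → Ω → Ω → Prop
  /-- The intersection numbers `p_{ij}^k`. -/
  p : Fin (d + 1) → Fin (d + 1) → Fin (d + 1) → ℕ
  rel_zero : ∀ x y, rel 0 x y ↔ x = y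
  rel_nonempty : ∀ i, ∃ x y, rel i x y
  rel_partition : ∀ x y, ∃! i, rel i x y
  rel_transpose : ∀ j, ∃ j', ∀ x y, rel j' x y ↔ rel j y x
  card_eq : ∀ i j k x y, rel k x y → {z | rel i x z ∧ rel j z y}.ncard = p i j k
  p_comm : ∀ i j k, p i j k = p j i k

namespace AssociationScheme

open Classical in
/-- The adjacency matrix `A_i` of the relation `R_i`. -/
noncomputable def adj {d : ℕ} {Ω : Type*} [Fintype Ω] (X : AssociationScheme d Ω)
    (i : Fin (d + 1)) : Matrix Ω Ω ℂ :=
  Matrix.of fun x y => if X.rel i x y then 1 else 0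

/-- The Bose–Mesner algebra, as the complex span of the adjacency matrices. -/
noncomputable def boseMesner {d : ℕ} {Ω : Type*} [Fintype Ω] (X : AssociationScheme d Ω) :
    Submodule ℂ (Matrix Ω Ω ℂ) :=
  Submodule.span ℂ (Set.range X.adj)

/-- The primitive (that is, minimal nonzero) idempotents of the Bose–Mesner algebra. -/
def primitiveIdempotents {d : ℕ} {Ω : Type*} [Fintype Ω] (X : AssociationScheme d Ω) :
    Set (Matrix Ω Ω ℂ) :=
  {E | E ∈ X.boseMesner ∧ E * E = E ∧ E ≠ 0 ∧
    ∀ F ∈ X.boseMesner, F * F = F → E * F = F → F = 0 ∨ F = E}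

/-- `P` is a (first) eigenmatrix of the scheme, for its given ordering of the relations: for some
ordering `E_0, …, E_d` of the primitive idempotents,
`(A_0, …, A_d) = (E_0, …, E_d) P`, i.e. `A_j = ∑ i, P i j • E_i`. -/
def HasEigenmatrix {d : ℕ} {Ω : Type*} [Fintype Ω] (X : AssociationScheme d Ω)
    (P : Matrix (Fin (d + 1)) (Fin (d + 1)) ℂ) : Prop :=
  ∃ E : Fin (d + 1) → Matrix Ω Ω ℂ,
    Function.Injective E ∧ Set.range E = X.primitiveIdempotents ∧
      ∀ j, X.adj j = ∑ i, P i j • E i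

/-- The triple intersection number `[i j k]` with respect to the vertices `u, v, w`. -/
noncomputable def tripleNumber {d : ℕ} {Ω : Type*} [Fintype Ω] (X : AssociationScheme d Ω)
    (u v w : Ω) (i j k : Fin (d + 1)) : ℕ :=
  {x | X.rel i u x ∧ X.rel j v x ∧ X.rel k w x}.ncard

/-- Triple intersection numbers depend only on `i, j, k` and on the relations between the three
vertices. -/
def TriplyRegular {d : ℕ} {Ω : Type*} [Fintype Ω] (X : AssociationScheme d Ω) : Prop :=
  ∀ (U V W : Fin (d + 1)) (u v w u' v' w' : Ω),
    X.rel U v w → X.rel V u w → X.rel W u v →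
    X.rel U v' w' → X.rel V u' w' → X.rel W u' v' →
    ∀ i j k, X.tripleNumber u v w i j k = X.tripleNumber u' v' w' i j k

/-- The relation `R_i` is thin if it has valency one. -/
def IsThin {d : ℕ} {Ω : Type*} [Fintype Ω] (X : AssociationScheme d Ω) (i : Fin (d + 1)) : Prop :=
  ∀ z, {x | X.rel i z x}.ncard = 1

/-- The neighbourhood `R_i(z)`, as a type. -/
def Nbhd {d : ℕ} {Ω : Type*} [Fintype Ω] (X : AssociationScheme d Ω) (i : Fin (d + 1)) (z : Ω) :
    Type _ :=
  {x : Ω // X.rel i z x}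

noncomputable instance {d : ℕ} {Ω : Type*} [Fintype Ω] (X : AssociationScheme d Ω)
    (i : Fin (d + 1)) (z : Ω) : Fintype (X.Nbhd i z) :=
  @Fintype.ofFinite _ (inferInstanceAs (Finite {x : Ω // X.rel i z x}))

/-- The restriction `R_j'` of the relation `R_j` to the neighbourhood `R_i(z)`. -/
def restrict {d : ℕ} {Ω : Type*} [Fintype Ω] (X : AssociationScheme d Ω) (i : Fin (d + 1)) (z : Ω)
    (j : Fin (d + 1)) : X.Nbhd i z → X.Nbhd i z → Prop :=
  fun x y => X.rel j x.1 y.1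

/-- `Y` is the local scheme of `X` on the neighbourhood `R_i(z)`: its set of relations is the set
of the nonempty restrictions `R_j'`. (So the relations of `Y`, as a set, are determined by
`X`, `i`, `z`; only their numbering is chosen.) -/
def IsLocalScheme {d e : ℕ} {Ω : Type*} [Fintype Ω] (X : AssociationScheme d Ω) (i : Fin (d + 1))
    (z : Ω) (Y : AssociationScheme e (X.Nbhd i z)) : Prop :=
  Set.range Y.rel = {S | (∃ x y, S x y) ∧ ∃ j, S = X.restrict i z j}

end AssociationScheme

open Complex in
/-- The eigenmatrix of Hoggar's scheme. -/
noncomputable def hoggarEigenmatrix : Matrix (Fin (7 + 1)) (Fin (7 + 1)) ℂ :=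
  !![1,  1,  1,  1, 63,      63,  63,      63;
     1,  I, -1, -I, 21,  21 * I, -21, -21 * I;
     1, -1,  1, -1, -9,       9,  -9,       9;
     1, -I, -1,  I, 21, -21 * I, -21,  21 * I;
     1,  1,  1,  1, -1,      -1,  -1,      -1;
     1,  I, -1, -I, -3,  -3 * I,   3,   3 * I;
     1, -1,  1, -1,  7,      -7,   7,      -7;
     1, -I, -1,  I, -3,   3 * I,   3,  -3 * I]

open Complex in
/-- The eigenmatrix of the 4-class fission scheme of the collinearity graph of the split Cayley
hexagon `H(2)`. -/
noncomputable def hexFissionEigenmatrix : Matrix (Fin (4 + 1)) (Fin (4 + 1)) ℂ :=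
  !![1,  6,         16, 24,         16;
     1,  3,         -2,  0,         -2;
     1, -1,          2, -4,          2;
     1, -3, -2 + 6 * I,  6, -2 - 6 * I;
     1, -3, -2 - 6 * I,  6, -2 + 6 * I]

/-! The thin relations compose like the cyclic group of order 4 and shift the thick ones among
themselves, so a relation amounts to a block (thin or thick) and a phase in {1, i, -1, -i}. Fourier
analysis in the phase replaces indicators of relations by `thinPow a` and `thickPow a`, and triple
regularity becomes the claim that sums over x of products of three such functions of (u,x), (v,x),
(w,x) depend only on the relations between u, v, w.

A sum with a thin factor is evaluated by the composition rule (`tripleSum_thinPow`). For thick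
factors with exponents a, b, c, moving x along thin relations shows that the sum vanishes unless a +
b + c ≡ 0 mod 4; if some exponent is 0, it reduces to an entry of a product of two matrices. Up to
order only (1,1,2) and its conjugate (3,3,2) remain. These are settled by a vanishing Krein
parameter: `gramPow` and `altPow` give multiples of E_3 and E_2, while the entrywise square of E_3
is a multiple of E_6, hence orthogonal to E_2. A sum-of-squares argument then yields ∑_x E_3(u,x)
E_3(v,x) E_2(w,x) = 0 for all u, v, w (`sum_gramPow_gramPow_altPow`); expanded, this contains the
(1,1,2) sum as its only unknown.

On a thick neighbourhood R_i(z) distinct points are never thinly related, so the local relations are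
described by the identity and the matrices `localPow e a`. The same triple sums, with z as a vertex,
give their multiplication table; from it the five idempotents `localIdem` are verified and the
eigenmatrix is read off. Triple regularity supplies the intersection numbers. -/

open Matrix Finset

namespace AssociationScheme

/-! ### The Bose–Mesner algebra and its primitive idempotents -/

section General

variable {d : ℕ} {Ω : Type*} [Fintype Ω] (X : AssociationScheme d Ω)

/-- The index of the relation containing `(x, y)`. -/
noncomputable def idx (x y : Ω) : Fin (d + 1) := (X.rel_partition x y).choose

theorem rel_iff_idx {i : Fin (d + 1)} {x y : Ω} : X.rel i x y ↔ X.idx x y = i :=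
  ⟨fun h => ((X.rel_partition x y).choose_spec.2 i h).symm,
    fun h => h ▸ (X.rel_partition x y).choose_spec.1⟩

theorem idx_eq_zero {x y : Ω} : X.idx x y = 0 ↔ x = y := by
  rw [← rel_iff_idx, X.rel_zero]

theorem adj_apply (i : Fin (d + 1)) (x y : Ω) :
    X.adj i x y = if X.idx x y = i then 1 else 0 := by
  simp only [adj, Matrix.of_apply, rel_iff_idx]

theorem rel_injective : Function.Injective X.rel := by
  intro i j hij
  obtain ⟨x, y, h⟩ := X.rel_nonempty i
  have h' : X.rel j x y := hij ▸ h
  rw [rel_iff_idx] at h h'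
  exact h.symm.trans h'

theorem adj_zero [DecidableEq Ω] : X.adj 0 = 1 := by
  ext x y
  simp only [adj_apply, idx_eq_zero, Matrix.one_apply]

theorem adj_mul_adj_apply (i j : Fin (d + 1)) (x y : Ω) :
    (X.adj i * X.adj j) x y = ({z | X.rel i x z ∧ X.rel j z y}.ncard : ℂ) := by
  classical
  simp only [Matrix.mul_apply, adj_apply, rel_iff_idx, ← ite_and, ite_mul, one_mul, zero_mul]
  rw [Finset.sum_boole, Set.ncard_eq_toFinset_card']
  congr 2
  ext z
  simp

theorem adj_mul_adj (i j : Fin (d + 1)) :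
    X.adj i * X.adj j = ∑ k, (X.p i j k : ℂ) • X.adj k := by
  ext x y
  rw [adj_mul_adj_apply, X.card_eq i j (X.idx x y) x y (X.rel_iff_idx.2 rfl)]
  simp [Matrix.sum_apply, adj_apply]

theorem adj_mul_adj_comm (i j : Fin (d + 1)) : X.adj i * X.adj j = X.adj j * X.adj i := by
  simp only [adj_mul_adj, X.p_comm i j]

theorem adj_mem_boseMesner (i : Fin (d + 1)) : X.adj i ∈ X.boseMesner :=
  Submodule.subset_span ⟨i, rfl⟩

theorem mul_mem_boseMesner {M N : Matrix Ω Ω ℂ} (hM : M ∈ X.boseMesner)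
    (hN : N ∈ X.boseMesner) : M * N ∈ X.boseMesner := by
  induction hM using Submodule.span_induction with
  | mem M hM =>
    obtain ⟨i, rfl⟩ := hM
    induction hN using Submodule.span_induction with
    | mem N hN =>
      obtain ⟨j, rfl⟩ := hN
      rw [adj_mul_adj]
      exact Submodule.sum_mem _ fun k _ => Submodule.smul_mem _ _ (X.adj_mem_boseMesner k)
    | zero => simp
    | add N N' _ _ h h' => rw [mul_add]; exact Submodule.add_mem _ h h'
    | smul c N _ h => rw [mul_smul_comm]; exact Submodule.smul_mem _ _ h
  | zero => simp
  | add M M' _ _ h h' => rw [add_mul]; exact Submodule.add_mem _ h h'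
  | smul c M _ h => rw [smul_mul_assoc]; exact Submodule.smul_mem _ _ h

theorem boseMesner_mul_comm {M N : Matrix Ω Ω ℂ} (hM : M ∈ X.boseMesner)
    (hN : N ∈ X.boseMesner) : M * N = N * M := by
  induction hM using Submodule.span_induction with
  | mem M hM =>
    obtain ⟨i, rfl⟩ := hM
    induction hN using Submodule.span_induction with
    | mem N hN =>
      obtain ⟨j, rfl⟩ := hN
      exact X.adj_mul_adj_comm i j
    | zero => simp
    | add N N' _ _ h h' => rw [mul_add, add_mul, h, h']
    | smul c N _ h => rw [mul_smul_comm, smul_mul_assoc, h]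
  | zero => simp
  | add M M' _ _ h h' => rw [mul_add, add_mul, h, h']
  | smul c M _ h => rw [mul_smul_comm, smul_mul_assoc, h]

/-- By commutativity E * F is an idempotent below both factors, so if nonzero it equals each of
them. -/
theorem primitiveIdempotents_mul_eq_zero {E F : Matrix Ω Ω ℂ}
    (hE : E ∈ X.primitiveIdempotents) (hF : F ∈ X.primitiveIdempotents) (hne : E ≠ F) :
    E * F = 0 := by
  obtain ⟨hE₁, hE₂, -, hE₄⟩ := hE
  obtain ⟨hF₁, hF₂, -, hF₄⟩ := hF
  have hc := X.boseMesner_mul_comm hE₁ hF₁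
  have hm := X.mul_mem_boseMesner hE₁ hF₁
  have hi : E * F * (E * F) = E * F := by
    calc E * F * (E * F) = E * (F * E) * F := by simp only [mul_assoc]
      _ = E * E * (F * F) := by rw [← hc]; simp only [mul_assoc]
      _ = E * F := by rw [hE₂, hF₂]
  rcases hE₄ _ hm hi (by rw [← mul_assoc, hE₂]) with h | h
  · exact h
  rcases hF₄ _ hm hi (by rw [hc, ← mul_assoc, hF₂]) with h' | h'
  · exact h'
  · exact absurd (h.symm.trans h') hne

/-- The element `∑ j, f j • A_j` of the Bose–Mesner algebra. -/
noncomputable def combo (f : Fin (d + 1) → ℂ) : Matrix Ω Ω ℂ := ∑ j, f j • X.adj j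

theorem combo_apply (f : Fin (d + 1) → ℂ) (x y : Ω) : X.combo f x y = f (X.idx x y) := by
  simp [combo, Matrix.sum_apply, adj_apply]

/-- Multiplication in the Bose–Mesner algebra is pointwise multiplication of eigenvalues. -/
theorem HasEigenmatrix.combo_mul_combo {X : AssociationScheme d Ω}
    {P : Matrix (Fin (d + 1)) (Fin (d + 1)) ℂ} (hP : X.HasEigenmatrix P)
    {f g h : Fin (d + 1) → ℂ} (hfg : (P *ᵥ f) * (P *ᵥ g) = P *ᵥ h) :
    X.combo f * X.combo g = X.combo h := by
  obtain ⟨E, hinj, hE, hA⟩ := hP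
  have key : ∀ f, X.combo f = ∑ i, (P *ᵥ f) i • E i := by
    intro f
    simp only [combo, hA, Finset.smul_sum, smul_smul]
    rw [Finset.sum_comm]
    simp only [← Finset.sum_smul, Matrix.mulVec, dotProduct, mul_comm]
  have hmem : ∀ i, E i ∈ X.primitiveIdempotents := fun i => hE ▸ ⟨i, rfl⟩
  have horth : ∀ i j, E i * E j = if i = j then E i else 0 := by
    intro i j
    split_ifs with hij
    · subst hij; exact (hmem i).2.1
    · exact X.primitiveIdempotents_mul_eq_zero (hmem i) (hmem j) (hinj.ne hij)
  simp only [key, ← hfg, Finset.sum_mul, Finset.mul_sum, smul_mul_assoc, mul_smul_comm, horth,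
    smul_smul, smul_ite, smul_zero, Finset.sum_ite_eq', Finset.mem_univ,
    if_true, Pi.mul_apply]
  simp only [mul_comm]

/-- Orthogonal nonzero idempotents in the Bose–Mesner algebra that express the adjacency matrices
are the primitive idempotents. -/
theorem hasEigenmatrix_of_orthogonal {P : Matrix (Fin (d + 1)) (Fin (d + 1)) ℂ}
    (E : Fin (d + 1) → Matrix Ω Ω ℂ) (hmem : ∀ i, E i ∈ X.boseMesner) (hne : ∀ i, E i ≠ 0)
    (horth : ∀ i j, E i * E j = if i = j then E i else 0)
    (hA : ∀ j, X.adj j = ∑ i, P i j • E i) : X.HasEigenmatrix P := by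
  have hinj : Function.Injective E := by
    intro i j hij
    by_contra h
    have h1 := horth i j
    rw [if_neg h, ← hij, horth i i, if_pos rfl] at h1
    exact hne i h1
  have hspan : ∀ F ∈ X.boseMesner, ∃ c : Fin (d + 1) → ℂ, F = ∑ k, c k • E k := by
    intro F hF
    induction hF using Submodule.span_induction with
    | mem M hM => obtain ⟨j, rfl⟩ := hM; exact ⟨fun k => P k j, hA j⟩
    | zero => exact ⟨0, by simp⟩
    | add M N _ _ h h' =>
      obtain ⟨c, rfl⟩ := h
      obtain ⟨c', rfl⟩ := h'
      exact ⟨c + c', by simp [add_smul, Finset.sum_add_distrib]⟩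
    | smul a M _ h =>
      obtain ⟨c, rfl⟩ := h
      exact ⟨a • c, by simp [Finset.smul_sum, smul_smul]⟩
  have hmul : ∀ (c : Fin (d + 1) → ℂ) i, E i * ∑ k, c k • E k = c i • E i := by
    intro c i
    simp [Finset.mul_sum, mul_smul_comm, horth]
  -- Multiplying by E i isolates the i-th coordinate, which satisfies c² = c.
  have hidem : ∀ (c : Fin (d + 1) → ℂ),
      (∑ k, c k • E k) * (∑ k, c k • E k) = ∑ k, c k • E k → ∀ i, c i = 0 ∨ c i = 1 := by
    intro c hc i
    have h1 := congrArg (fun M => E i * M) hc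
    simp only [← mul_assoc, hmul, smul_mul_assoc, smul_smul] at h1
    have h2 : (c i * c i - c i) • E i = 0 := by rw [sub_smul, h1, sub_self]
    rcases smul_eq_zero.1 h2 with h3 | h3
    · have h4 : c i * (c i - 1) = 0 := by linear_combination h3
      rcases mul_eq_zero.1 h4 with h5 | h5
      · exact Or.inl h5
      · exact Or.inr (sub_eq_zero.1 h5)
    · exact absurd h3 (hne i)
  refine ⟨E, hinj, ?_, hA⟩
  ext F
  constructor
  · rintro ⟨i, rfl⟩
    refine ⟨hmem i, by simp [horth], hne i, fun F hF hFF hEF => ?_⟩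
    obtain ⟨c, rfl⟩ := hspan F hF
    rw [hmul] at hEF
    rw [← hEF]
    rcases hidem c hFF i with h | h
    · left; simp [h]
    · right; simp [h]
  · rintro ⟨hF, hFF, hF0, hmin⟩
    obtain ⟨c, rfl⟩ := hspan F hF
    obtain ⟨i, hi⟩ : ∃ i, c i ≠ 0 := by
      by_contra! h
      exact hF0 (by simp [h])
    have hi1 : c i = 1 := (hidem c hFF i).resolve_left hi
    -- A coordinate equal to 1 puts E i below F, and minimality of F forces equality.
    rcases hmin (E i) (hmem i) (by simp [horth])
      (by rw [X.boseMesner_mul_comm hF (hmem i), hmul, hi1, one_smul]) with h | h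
    · exact absurd h (hne i)
    · exact ⟨i, h⟩

/-- A scheme whose relation set is that of another one has the same number of classes. -/
theorem classes_eq_of_range_rel_eq {e : ℕ} {X : AssociationScheme d Ω}
    {Y : AssociationScheme e Ω} (h : Set.range Y.rel = Set.range X.rel) : e = d := by
  have h1 := congrArg Set.ncard h
  rw [← Set.image_univ, ← Set.image_univ, Set.ncard_image_of_injective _ Y.rel_injective,
    Set.ncard_image_of_injective _ X.rel_injective] at h1
  simpa using h1

end General

end AssociationScheme

/-! ### Phases and the eigenvalues of their powers -/

/-- The fourth root of unity attached to a relation of Hoggar's scheme. -/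
noncomputable def hoggarPhase : Fin (7 + 1) → ℂ :=
  ![1, Complex.I, -1, -Complex.I, 1, Complex.I, -1, -Complex.I]

/-- The composition of a relation of Hoggar's scheme with a thin one. -/
def hoggarShift (k j : Fin (7 + 1)) : Fin (7 + 1) :=
  ⟨k.val / 4 * 4 + (k.val + j.val) % 4, by omega⟩

/-- The index of the transpose of a relation of Hoggar's scheme. -/
def hoggarInv (j : Fin (7 + 1)) : Fin (7 + 1) :=
  ⟨j.val / 4 * 4 + (4 - j.val % 4) % 4, by omega⟩

/-- Powers of the phase, supported on the thin relations. -/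
noncomputable def thinPow (a : ℕ) (j : Fin (7 + 1)) : ℂ := if j.val < 4 then hoggarPhase j ^ a else 0

/-- Powers of the phase, supported on the thick relations. -/
noncomputable def thickPow (a : ℕ) (j : Fin (7 + 1)) : ℂ := if j.val < 4 then 0 else hoggarPhase j ^ a

theorem hoggarPhase_pow_four (j : Fin (7 + 1)) : hoggarPhase j ^ 4 = 1 := by
  fin_cases j <;> norm_num [hoggarPhase]

theorem hoggarPhase_inv (j : Fin (7 + 1)) : hoggarPhase (hoggarInv j) = star (hoggarPhase j) := by
  fin_cases j <;> simp [hoggarPhase, hoggarInv]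

theorem hoggarPhase_mul_star (j : Fin (7 + 1)) : hoggarPhase j * star (hoggarPhase j) = 1 := by
  fin_cases j <;> simp [hoggarPhase]

theorem hoggarPhase_shift (k j : Fin (7 + 1)) :
    hoggarPhase (hoggarShift k j) = hoggarPhase k * hoggarPhase j := by
  fin_cases k <;> fin_cases j <;> simp [hoggarPhase, hoggarShift]

theorem hoggarShift_lt_four (k j : Fin (7 + 1)) : (hoggarShift k j).val < 4 ↔ k.val < 4 := by
  simp only [hoggarShift]; omega

theorem hoggarInv_lt_four (j : Fin (7 + 1)) : (hoggarInv j).val < 4 ↔ j.val < 4 := by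
  simp only [hoggarInv]; omega

/-- In each row, both blocks of four columns are geometric progressions with the same ratio, a
fourth root of unity, and the thin block starts at 1. -/
theorem hoggarEigenmatrix_mul (i k j : Fin (7 + 1)) (hj : j.val < 4) :
    hoggarEigenmatrix i k * hoggarEigenmatrix i j = hoggarEigenmatrix i (hoggarShift k j) := by
  have hj' : j = 0 ∨ j = 1 ∨ j = 2 ∨ j = 3 := by
    fin_cases j <;> simp_all
  rcases hj' with rfl | rfl | rfl | rfl <;> fin_cases k <;> fin_cases i <;>
    simp [hoggarEigenmatrix, hoggarShift, mul_assoc]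

theorem thinPow_mod (a : ℕ) : thinPow (a % 4) = thinPow a := by
  funext j
  simp only [thinPow, ← pow_eq_pow_mod a (hoggarPhase_pow_four j)]


theorem thickPow_mod (a : ℕ) : thickPow (a % 4) = thickPow a := by
  funext j
  simp only [thickPow, ← pow_eq_pow_mod a (hoggarPhase_pow_four j)]

theorem thinPow_eq (a : ℕ) :
    thinPow a = ![1, Complex.I ^ a, (-1) ^ a, (-Complex.I) ^ a, 0, 0, 0, 0] := by
  funext i
  fin_cases i <;> simp [thinPow, hoggarPhase]

theorem thickPow_eq (a : ℕ) :
    thickPow a = ![0, 0, 0, 0, 1, Complex.I ^ a, (-1) ^ a, (-Complex.I) ^ a] := by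
  funext i
  fin_cases i <;> simp [thickPow, hoggarPhase]

theorem hoggarEigenmatrix_mulVec (a b c d a' b' c' d' : ℂ) :
    hoggarEigenmatrix *ᵥ ![a, b, c, d, a', b', c', d'] =
      ![a + b + c + d + 63 * (a' + b' + c' + d'),
        a + Complex.I * b - c - Complex.I * d + 21 * (a' + Complex.I * b' - c' - Complex.I * d'),
        a - b + c - d - 9 * (a' - b' + c' - d'),
        a - Complex.I * b - c + Complex.I * d + 21 * (a' - Complex.I * b' - c' + Complex.I * d'),
        a + b + c + d - (a' + b' + c' + d'),
        a + Complex.I * b - c - Complex.I * d - 3 * (a' + Complex.I * b' - c' - Complex.I * d'),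
        a - b + c - d + 7 * (a' - b' + c' - d'),
        a - Complex.I * b - c + Complex.I * d - 3 * (a' - Complex.I * b' - c' + Complex.I * d')] := by
  simp only [hoggarEigenmatrix, Matrix.cons_mulVec, Matrix.cons_dotProduct,
    Matrix.dotProduct_of_isEmpty, Matrix.empty_mulVec, Matrix.vecHead, Matrix.vecTail]
  funext i
  fin_cases i <;> simp <;> ring

theorem hoggarEigenmatrix_mulVec_one :
    hoggarEigenmatrix *ᵥ ![1, 1, 1, 1, 1, 1, 1, 1] = ![256, 0, 0, 0, 0, 0, 0, 0] := by
  rw [hoggarEigenmatrix_mulVec]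
  congr! 1 <;> norm_num

/-- By orthogonality of the characters of ℤ/4, the a-th power of the phase, on either block, has
nonzero eigenvalues only in the two rows congruent to -a mod 4. -/
theorem hoggarEigenmatrix_mulVec_thinPow_zero :
    hoggarEigenmatrix *ᵥ thinPow 0 = ![4, 0, 0, 0, 4, 0, 0, 0] := by
  rw [thinPow_eq, hoggarEigenmatrix_mulVec]
  funext i
  fin_cases i <;> norm_num

theorem hoggarEigenmatrix_mulVec_thinPow_one :
    hoggarEigenmatrix *ᵥ thinPow 1 = ![0, 0, 0, 4, 0, 0, 0, 4] := by
  rw [thinPow_eq, hoggarEigenmatrix_mulVec]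
  funext i
  fin_cases i <;> norm_num <;> ring

theorem hoggarEigenmatrix_mulVec_thinPow_two :
    hoggarEigenmatrix *ᵥ thinPow 2 = ![0, 0, 4, 0, 0, 0, 4, 0] := by
  rw [thinPow_eq, hoggarEigenmatrix_mulVec]
  funext i
  fin_cases i <;> norm_num

theorem hoggarEigenmatrix_mulVec_thinPow_three :
    hoggarEigenmatrix *ᵥ thinPow 3 = ![0, 4, 0, 0, 0, 4, 0, 0] := by
  rw [thinPow_eq, hoggarEigenmatrix_mulVec]
  funext i
  fin_cases i <;> norm_num [Complex.I_pow_three, Odd.neg_pow (show Odd 3 by decide)]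

theorem hoggarEigenmatrix_mulVec_thickPow_zero :
    hoggarEigenmatrix *ᵥ thickPow 0 = ![252, 0, 0, 0, -4, 0, 0, 0] := by
  rw [thickPow_eq, hoggarEigenmatrix_mulVec]
  funext i
  fin_cases i <;> norm_num

theorem hoggarEigenmatrix_mulVec_thickPow_one :
    hoggarEigenmatrix *ᵥ thickPow 1 = ![0, 0, 0, 84, 0, 0, 0, -12] := by
  rw [thickPow_eq, hoggarEigenmatrix_mulVec]
  funext i
  fin_cases i <;> norm_num <;> ring

theorem hoggarEigenmatrix_mulVec_thickPow_two :
    hoggarEigenmatrix *ᵥ thickPow 2 = ![0, 0, -36, 0, 0, 0, 28, 0] := by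
  rw [thickPow_eq, hoggarEigenmatrix_mulVec]
  funext i
  fin_cases i <;> norm_num

theorem hoggarEigenmatrix_mulVec_thickPow_three :
    hoggarEigenmatrix *ᵥ thickPow 3 = ![0, 84, 0, 0, 0, -12, 0, 0] := by
  rw [thickPow_eq, hoggarEigenmatrix_mulVec]
  funext i
  fin_cases i <;> norm_num [Complex.I_pow_three, Odd.neg_pow (show Odd 3 by decide)]

/-- The eigenvalues of the matrices of phase powers on the local schemes. -/
def localEigenvalue : ℕ → ℂ
  | 0 => 62
  | 2 => -2
  | _ => 18

/-- After division by 4 the two nonzero eigenvalues of `thickPow b` are 63, -1 or 21, -3 or -9, 7.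
Their product is -63 and their sum is `localEigenvalue b`, so they are the roots of t² = 63 +
`localEigenvalue b` t. -/
theorem hoggarEigenmatrix_mulVec_thickPow_sq (b : ℕ) (hb : b < 4) :
    (hoggarEigenmatrix *ᵥ thickPow b) * (hoggarEigenmatrix *ᵥ thickPow b) =
      hoggarEigenmatrix *ᵥ ((4 : ℂ) • ((63 : ℂ) • thinPow b + localEigenvalue b • thickPow b)) := by
  have h : b = 0 ∨ b = 1 ∨ b = 2 ∨ b = 3 := by omega
  simp only [mulVec_smul, mulVec_add]
  rcases h with rfl | rfl | rfl | rfl <;>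
    simp only [hoggarEigenmatrix_mulVec_thinPow_zero, hoggarEigenmatrix_mulVec_thinPow_one,
      hoggarEigenmatrix_mulVec_thinPow_two, hoggarEigenmatrix_mulVec_thinPow_three,
      hoggarEigenmatrix_mulVec_thickPow_zero, hoggarEigenmatrix_mulVec_thickPow_one,
      hoggarEigenmatrix_mulVec_thickPow_two, hoggarEigenmatrix_mulVec_thickPow_three] <;>
    funext i <;> fin_cases i <;> norm_num [localEigenvalue]

/-- The entries of the rank 8 idempotent, up to a factor. -/
noncomputable def gramPow : Fin (7 + 1) → ℂ := thinPow 1 + (1 / 3 : ℂ) • thickPow 1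

/-- The entries of the rank 28 idempotent, up to a factor. -/
noncomputable def altPow : Fin (7 + 1) → ℂ := thinPow 2 + (-1 / 7 : ℂ) • thickPow 2

theorem gramPow_sq : gramPow * gramPow = thinPow 2 + (1 / 9 : ℂ) • thickPow 2 := by
  funext j
  simp only [gramPow, Pi.mul_apply, Pi.add_apply, Pi.smul_apply, thinPow, thickPow, smul_eq_mul]
  split_ifs <;> ring

/-- The coefficient 1/3 cancels the eigenvalue in row 7 (4 - 12/3 = 0); likewise -1/7 in `altPow`
cancels row 6, and 1/9 in the pointwise square of `gramPow` cancels row 2. Each is thus a multiple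
of one primitive idempotent. -/
theorem hoggarEigenmatrix_mulVec_gramPow :
    hoggarEigenmatrix *ᵥ gramPow = ![0, 0, 0, 32, 0, 0, 0, 0] := by
  rw [gramPow, mulVec_add, mulVec_smul, hoggarEigenmatrix_mulVec_thinPow_one,
    hoggarEigenmatrix_mulVec_thickPow_one]
  funext i
  fin_cases i <;> norm_num

theorem hoggarEigenmatrix_mulVec_altPow :
    hoggarEigenmatrix *ᵥ altPow = ![0, 0, 64 / 7, 0, 0, 0, 0, 0] := by
  rw [altPow, mulVec_add, mulVec_smul, hoggarEigenmatrix_mulVec_thinPow_two,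
    hoggarEigenmatrix_mulVec_thickPow_two]
  funext i
  fin_cases i <;> norm_num

theorem hoggarEigenmatrix_mulVec_gramPow_sq :
    hoggarEigenmatrix *ᵥ (gramPow * gramPow) = ![0, 0, 0, 0, 0, 0, 64 / 9, 0] := by
  rw [gramPow_sq, mulVec_add, mulVec_smul, hoggarEigenmatrix_mulVec_thinPow_two,
    hoggarEigenmatrix_mulVec_thickPow_two]
  funext i
  fin_cases i <;> norm_num

/-- The nonzero coefficient 63 at the identity is what identifies the transpose in `idx_swap`. The
coefficients 24, 16, 6, 16 are the valencies of the local schemes. -/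
theorem hoggarEigenmatrix_thick_mul_inv (i j : Fin (7 + 1)) (hj : ¬ j.val < 4) :
    hoggarEigenmatrix i j * hoggarEigenmatrix i (hoggarInv j) =
      (hoggarEigenmatrix *ᵥ ![63, 0, 0, 0, 24, 16, 6, 16]) i := by
  rw [hoggarEigenmatrix_mulVec]
  fin_cases j <;> simp at hj <;> fin_cases i <;>
    norm_num [hoggarEigenmatrix, hoggarInv, mul_mul_mul_comm] <;> ring_nf <;>
    norm_num

/-! ### Thin composition, transposes and the vanishing Krein parameter -/

namespace AssociationScheme

theorem adj_eq_combo {d : ℕ} {Ω : Type*} [Fintype Ω] (X : AssociationScheme d Ω)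
    (j : Fin (d + 1)) : X.adj j = X.combo (Pi.single j 1) := by
  ext x y
  rw [combo_apply, adj_apply, Pi.single_apply]

theorem sum_sum_sum_sum_mul {ι κ : Type*} [Fintype ι] [Fintype κ] (f g h : κ → ι → ℂ) :
    ∑ u, ∑ v, ∑ w, ∑ p, f p u * (g p v * h p w) =
      ∑ p, (∑ u, f p u) * ((∑ v, g p v) * (∑ w, h p w)) := by
  calc ∑ u, ∑ v, ∑ w, ∑ p, f p u * (g p v * h p w)
      = ∑ u, ∑ v, ∑ p, ∑ w, f p u * (g p v * h p w) :=
        Finset.sum_congr rfl fun u _ => Finset.sum_congr rfl fun v _ => Finset.sum_comm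
    _ = ∑ u, ∑ p, ∑ v, ∑ w, f p u * (g p v * h p w) :=
        Finset.sum_congr rfl fun u _ => Finset.sum_comm
    _ = ∑ p, ∑ u, ∑ v, ∑ w, f p u * (g p v * h p w) := Finset.sum_comm
    _ = _ := by simp only [← Finset.mul_sum, ← Finset.sum_mul]

section Hoggar

variable {Ω : Type*} [Fintype Ω] {X : AssociationScheme 7 Ω}

/-- The composition rule for a thin relation. -/
theorem idx_eq_shift (hX : X.HasEigenmatrix hoggarEigenmatrix) {v u x : Ω}
    (h : (X.idx u x).val < 4) : X.idx v x = hoggarShift (X.idx v u) (X.idx u x) := by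
  set k := X.idx v u with hk
  set j := X.idx u x with hj
  have hmul : X.adj k * X.adj j = X.adj (hoggarShift k j) := by
    simp only [adj_eq_combo]
    apply hX.combo_mul_combo
    funext i
    simp only [Pi.mul_apply, Matrix.mulVec_single_one, Matrix.col_apply]
    exact hoggarEigenmatrix_mul i k j h
  have hent := congrFun (congrFun hmul v) x
  rw [adj_mul_adj_apply, adj_apply] at hent
  have hpos : {z | X.rel k v z ∧ X.rel j z x}.ncard ≠ 0 :=
    Set.ncard_ne_zero_of_mem (a := u) ⟨X.rel_iff_idx.2 rfl, X.rel_iff_idx.2 rfl⟩ (Set.toFinite _)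
  by_contra hne
  rw [if_neg hne] at hent
  exact hpos (by exact_mod_cast hent)

/-- The transposes of the relations. -/
theorem idx_swap (hX : X.HasEigenmatrix hoggarEigenmatrix) (x y : Ω) :
    X.idx y x = hoggarInv (X.idx x y) := by
  set j := X.idx x y with hj
  obtain ⟨c, hc, hmul⟩ : ∃ c : Fin (7 + 1) → ℂ, c 0 ≠ 0 ∧
      X.adj j * X.adj (hoggarInv j) = X.combo c := by
    by_cases h : j.val < 4
    · refine ⟨Pi.single 0 1, by simp, ?_⟩
      simp only [adj_eq_combo]
      apply hX.combo_mul_combo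
      funext i
      simp only [Pi.mul_apply, Matrix.mulVec_single_one, Matrix.col_apply]
      rw [hoggarEigenmatrix_mul i j _ ((hoggarInv_lt_four j).2 h)]
      congr 1
      ext
      simp only [hoggarShift, hoggarInv, Fin.val_zero]
      omega
    · refine ⟨![63, 0, 0, 0, 24, 16, 6, 16], by simp, ?_⟩
      simp only [adj_eq_combo]
      apply hX.combo_mul_combo
      funext i
      simp only [Pi.mul_apply, Matrix.mulVec_single_one, Matrix.col_apply]
      exact hoggarEigenmatrix_thick_mul_inv i j h
  have hent := congrFun (congrFun hmul x) x
  rw [adj_mul_adj_apply, combo_apply, X.idx_eq_zero.2 rfl] at hent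
  -- The nonzero diagonal entry shows that the transpose of R_j, itself a relation, shares a pair
  -- with the one indexed by `hoggarInv j`; the two therefore coincide.
  obtain ⟨z, hz₁, hz₂⟩ : {z | X.rel j x z ∧ X.rel (hoggarInv j) z x}.Nonempty := by
    rw [Set.nonempty_iff_ne_empty]
    intro h
    rw [h] at hent
    exact hc (by simpa using hent.symm)
  obtain ⟨j', hj'⟩ := X.rel_transpose j
  have h1 : X.rel j' z x := (hj' z x).2 hz₁
  have h2 : X.rel j' y x := (hj' y x).2 (X.rel_iff_idx.2 rfl)
  rw [rel_iff_idx] at h1 h2 hz₂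
  rw [h2, ← h1, hz₂]

theorem thin_swap (hX : X.HasEigenmatrix hoggarEigenmatrix) (x y : Ω) :
    (X.idx y x).val < 4 ↔ (X.idx x y).val < 4 := by
  rw [idx_swap hX x y, hoggarInv_lt_four]

theorem phase_swap (hX : X.HasEigenmatrix hoggarEigenmatrix) (x y : Ω) :
    hoggarPhase (X.idx y x) = star (hoggarPhase (X.idx x y)) := by
  rw [idx_swap hX x y, hoggarPhase_inv]

theorem thinPow_swap (hX : X.HasEigenmatrix hoggarEigenmatrix) (a : ℕ) (x y : Ω) :
    thinPow a (X.idx y x) = star (thinPow a (X.idx x y)) := by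
  simp only [thinPow, thin_swap hX x y, phase_swap hX x y]
  split_ifs <;> simp

theorem thickPow_swap (hX : X.HasEigenmatrix hoggarEigenmatrix) (a : ℕ) (x y : Ω) :
    thickPow a (X.idx y x) = star (thickPow a (X.idx x y)) := by
  simp only [thickPow, thin_swap hX x y, phase_swap hX x y]
  split_ifs <;> simp

/-- When x is thinly related to u, the phase of (v,x) is that of (v,u) times that of (u,x), and the
block is unchanged; this removes v from a sum over x. -/
theorem thinPow_mul_thinPow_shift (hX : X.HasEigenmatrix hoggarEigenmatrix) (a b : ℕ) (v u x : Ω) :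
    thinPow a (X.idx u x) * thinPow b (X.idx v x) =
      thinPow b (X.idx v u) * thinPow (a + b) (X.idx u x) := by
  by_cases h : (X.idx u x).val < 4
  · simp only [thinPow, idx_eq_shift hX (v := v) h, hoggarShift_lt_four, hoggarPhase_shift, if_pos h]
    split_ifs <;> ring
  · simp [thinPow, h]

theorem thinPow_mul_thickPow_shift (hX : X.HasEigenmatrix hoggarEigenmatrix) (a b : ℕ)
    (v u x : Ω) : thinPow a (X.idx u x) * thickPow b (X.idx v x) =
      thickPow b (X.idx v u) * thinPow (a + b) (X.idx u x) := by
  by_cases h : (X.idx u x).val < 4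
  · simp only [thinPow, thickPow, idx_eq_shift hX (v := v) h, hoggarShift_lt_four,
      hoggarPhase_shift, if_pos h]
    split_ifs <;> ring
  · simp [thinPow, h]

/-- The all-ones matrix is 256 times the idempotent of row 0, so multiplying by it extracts the
eigenvalue in that row. -/
theorem sum_combo_row (hX : X.HasEigenmatrix hoggarEigenmatrix) (f : Fin (7 + 1) → ℂ) (u : Ω) :
    ∑ x, f (X.idx u x) = (hoggarEigenmatrix *ᵥ f) 0 := by
  have hone : ∀ j : Fin (7 + 1), (![1, 1, 1, 1, 1, 1, 1, 1] : Fin (7 + 1) → ℂ) j = 1 := by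
    intro j; fin_cases j <;> rfl
  have h : X.combo f * X.combo ![1, 1, 1, 1, 1, 1, 1, 1] =
      X.combo ((hoggarEigenmatrix *ᵥ f) 0 • ![1, 1, 1, 1, 1, 1, 1, 1]) := by
    apply hX.combo_mul_combo
    rw [mulVec_smul, hoggarEigenmatrix_mulVec_one]
    funext i
    fin_cases i <;> simp
  have hent := congrFun (congrFun h u) u
  simpa only [Matrix.mul_apply, combo_apply, Pi.smul_apply, smul_eq_mul, hone, mul_one] using hent

theorem sum_thinPow (hX : X.HasEigenmatrix hoggarEigenmatrix) (a : ℕ) (u : Ω) :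
    ∑ x, thinPow a (X.idx u x) = if a % 4 = 0 then 4 else 0 := by
  rw [← thinPow_mod, sum_combo_row hX]
  have h : a % 4 = 0 ∨ a % 4 = 1 ∨ a % 4 = 2 ∨ a % 4 = 3 := by omega
  rcases h with h | h | h | h <;> rw [h] <;>
    simp [hoggarEigenmatrix_mulVec_thinPow_zero, hoggarEigenmatrix_mulVec_thinPow_one,
      hoggarEigenmatrix_mulVec_thinPow_two, hoggarEigenmatrix_mulVec_thinPow_three]

theorem sum_thickPow_mul_thickPow (hX : X.HasEigenmatrix hoggarEigenmatrix) {b : ℕ} (hb : b < 4)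
    (v w : Ω) : ∑ x, thickPow b (X.idx v x) * thickPow b (X.idx x w) =
      4 * (63 * thinPow b (X.idx v w) + localEigenvalue b * thickPow b (X.idx v w)) := by
  have h := hX.combo_mul_combo (hoggarEigenmatrix_mulVec_thickPow_sq b hb)
  have hent := congrFun (congrFun h v) w
  simpa only [Matrix.mul_apply, combo_apply, Pi.smul_apply, Pi.add_apply, smul_eq_mul] using hent

theorem gramPow_swap (hX : X.HasEigenmatrix hoggarEigenmatrix) (x y : Ω) :
    gramPow (X.idx y x) = star (gramPow (X.idx x y)) := by
  simp [gramPow, thinPow_swap hX _ x y, thickPow_swap hX _ x y]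

theorem altPow_swap (hX : X.HasEigenmatrix hoggarEigenmatrix) (x y : Ω) :
    altPow (X.idx y x) = star (altPow (X.idx x y)) := by
  simp [altPow, thinPow_swap hX _ x y, thickPow_swap hX _ x y]

/-- The vanishing triple sums coming from the vanishing Krein parameter. -/
theorem sum_gramPow_gramPow_altPow (hX : X.HasEigenmatrix hoggarEigenmatrix) (u v w : Ω) :
    ∑ x, gramPow (X.idx u x) * gramPow (X.idx v x) * altPow (X.idx w x) = 0 := by
  have hG : X.combo gramPow * X.combo gramPow = X.combo ((32 : ℂ) • gramPow) := by
    apply hX.combo_mul_combo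
    rw [mulVec_smul, hoggarEigenmatrix_mulVec_gramPow]
    funext i
    fin_cases i <;> norm_num
  have hB : X.combo altPow * X.combo altPow = X.combo ((64 / 7 : ℂ) • altPow) := by
    apply hX.combo_mul_combo
    rw [mulVec_smul, hoggarEigenmatrix_mulVec_altPow]
    funext i
    fin_cases i <;> norm_num
  have hC : X.combo (gramPow * gramPow) * X.combo altPow = X.combo 0 := by
    apply hX.combo_mul_combo
    rw [mulVec_zero, hoggarEigenmatrix_mulVec_altPow, hoggarEigenmatrix_mulVec_gramPow_sq]
    funext i
    fin_cases i <;> norm_num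
  have hG' : ∀ x y, ∑ u, gramPow (X.idx u x) * star (gramPow (X.idx u y)) =
      32 * gramPow (X.idx y x) := by
    intro x y
    have hent := congrFun (congrFun hG y) x
    simp only [Matrix.mul_apply, combo_apply, Pi.smul_apply, smul_eq_mul] at hent
    rw [← hent]
    exact Finset.sum_congr rfl fun u _ => by rw [← gramPow_swap hX u y, mul_comm]
  have hB' : ∀ x y, ∑ u, altPow (X.idx u x) * star (altPow (X.idx u y)) =
      64 / 7 * altPow (X.idx y x) := by
    intro x y
    have hent := congrFun (congrFun hB y) x
    simp only [Matrix.mul_apply, combo_apply, Pi.smul_apply, smul_eq_mul] at hent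
    rw [← hent]
    exact Finset.sum_congr rfl fun u _ => by rw [← altPow_swap hX u y, mul_comm]
  have hC' : ∀ y, ∑ x, gramPow (X.idx y x) * gramPow (X.idx y x) * altPow (X.idx x y) = 0 := by
    intro y
    have hent := congrFun (congrFun hC y) y
    simpa only [Matrix.mul_apply, combo_apply, Pi.mul_apply, Pi.zero_apply] using hent
  set S : Ω → Ω → Ω → ℂ := fun u v w =>
    ∑ x, gramPow (X.idx u x) * gramPow (X.idx v x) * altPow (X.idx w x) with hS
  -- Squared phases are ±1, hence invariant under conjugation.
  have halt : ∀ x y, altPow (X.idx y x) = altPow (X.idx x y) := by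
    intro x y
    have h2 : hoggarPhase (hoggarInv (X.idx x y)) ^ 2 = hoggarPhase (X.idx x y) ^ 2 := by
      generalize X.idx x y = j
      fin_cases j <;> simp [hoggarPhase, hoggarInv]
    simp only [altPow, thinPow, thickPow, Pi.add_apply, Pi.smul_apply, idx_swap hX x y,
      hoggarInv_lt_four, h2]
  -- After expanding |S|² as a double sum over x, y, the sums over u, v, w close up by idempotency.
  -- What is left is a multiple of the sum of the diagonal entries of (E_3 ∘ E_3) E_2, which vanish
  -- by `hC'`.
  have key : ∑ u, ∑ v, ∑ w, S u v w * star (S u v w) = 0 := by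
    have h1 : ∀ u v w, S u v w * star (S u v w) =
        ∑ x, ∑ y, (gramPow (X.idx u x) * star (gramPow (X.idx u y))) *
          ((gramPow (X.idx v x) * star (gramPow (X.idx v y))) *
            (altPow (X.idx w x) * star (altPow (X.idx w y)))) := by
      intro u v w
      simp only [hS, star_sum, Finset.sum_mul_sum, star_mul']
      exact Finset.sum_congr rfl fun x _ => Finset.sum_congr rfl fun y _ => by ring
    have h2 : ∑ u, ∑ v, ∑ w, S u v w * star (S u v w) =
        ∑ x, ∑ y, (∑ u, gramPow (X.idx u x) * star (gramPow (X.idx u y))) *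
          ((∑ v, gramPow (X.idx v x) * star (gramPow (X.idx v y))) *
            (∑ w, altPow (X.idx w x) * star (altPow (X.idx w y)))) := by
      have h3 := sum_sum_sum_sum_mul
        (fun (p : Ω × Ω) u => gramPow (X.idx u p.1) * star (gramPow (X.idx u p.2)))
        (fun p v => gramPow (X.idx v p.1) * star (gramPow (X.idx v p.2)))
        (fun p w => altPow (X.idx w p.1) * star (altPow (X.idx w p.2)))
      simpa only [h1, Fintype.sum_prod_type] using h3
    rw [h2, Finset.sum_comm]
    simp only [hG', hB']
    refine Finset.sum_eq_zero fun y _ => ?_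
    have h3 := congrArg (fun t => 32 * 32 * (64 / 7) * t) (hC' y)
    simp only [mul_zero, Finset.mul_sum] at h3
    rw [← h3]
    exact Finset.sum_congr rfl fun x _ => by rw [halt x y]; ring
  have hnn : ∀ z : ℂ, z * star z = ((‖z‖ ^ 2 : ℝ) : ℂ) := fun z => by
    rw [Complex.star_def, Complex.mul_conj, Complex.normSq_eq_norm_sq]
  simp only [hnn] at key
  have key' : ∑ u, ∑ v, ∑ w, ‖S u v w‖ ^ 2 = 0 := by exact_mod_cast key
  have hu := (Finset.sum_eq_zero_iff_of_nonneg (fun u _ => by positivity)).1 key' u (mem_univ u)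
  have hv := (Finset.sum_eq_zero_iff_of_nonneg (fun u _ => by positivity)).1 hu v (mem_univ v)
  have hw := (Finset.sum_eq_zero_iff_of_nonneg (fun u _ => by positivity)).1 hv w (mem_univ w)
  simpa using hw

end Hoggar

end AssociationScheme

/-! ### Triple sums of phase powers and triple regularity -/

/-- Powers of the phase, supported on the thin or on the thick relations. -/
noncomputable def phasePow : Bool → ℕ → Fin (7 + 1) → ℂ
  | true => thinPow
  | false => thickPow

theorem star_hoggarPhase (j : Fin (7 + 1)) : star (hoggarPhase j) = hoggarPhase j ^ 3 := by
  have h1 := hoggarPhase_mul_star j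
  have h4 := hoggarPhase_pow_four j
  calc star (hoggarPhase j) = hoggarPhase j ^ 4 * star (hoggarPhase j) := by rw [h4, one_mul]
    _ = hoggarPhase j ^ 3 * (hoggarPhase j * star (hoggarPhase j)) := by ring
    _ = _ := by rw [h1, mul_one]

theorem star_thinPow (a : ℕ) (j : Fin (7 + 1)) : star (thinPow a j) = thinPow (3 * a) j := by
  simp only [thinPow]
  split_ifs
  · rw [star_pow, star_hoggarPhase, ← pow_mul]
  · exact star_zero _

theorem star_thickPow (a : ℕ) (j : Fin (7 + 1)) : star (thickPow a j) = thickPow (3 * a) j := by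
  simp only [thickPow]
  split_ifs
  · exact star_zero _
  · rw [star_pow, star_hoggarPhase, ← pow_mul]

theorem thickPow_zero_eq (j : Fin (7 + 1)) : thickPow 0 j = 1 - thinPow 0 j := by
  simp only [thickPow, thinPow]
  split_ifs <;> simp

theorem thinPow_congr {a b : ℕ} (h : a % 4 = b % 4) : thinPow a = thinPow b := by
  rw [← thinPow_mod, h, thinPow_mod]

theorem thickPow_congr {a b : ℕ} (h : a % 4 = b % 4) : thickPow a = thickPow b := by
  rw [← thickPow_mod, h, thickPow_mod]

/-- Fourier inversion on ℤ/4 inside the block containing i. -/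
theorem single_eq_sum_phasePow (i : Fin (7 + 1)) :
    (Pi.single i 1 : Fin (7 + 1) → ℂ) = ∑ a ∈ Finset.range 4,
      ((1 / 4 : ℂ) * star (hoggarPhase i) ^ a) • phasePow (decide (i.val < 4)) a := by
  funext j
  simp only [Finset.sum_range_succ, Finset.sum_range_zero]
  fin_cases i <;> fin_cases j <;>
    norm_num [phasePow, thinPow, thickPow, hoggarPhase, Pi.single_apply, Complex.I_pow_three,
      Odd.neg_pow (show Odd 3 by decide), mul_assoc]

namespace AssociationScheme

section Hoggar

variable {Ω : Type*} [Fintype Ω] {X : AssociationScheme 7 Ω}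

/-- The sum over all vertices of a product of functions of the relations to three vertices. -/
noncomputable def tripleSum (X : AssociationScheme 7 Ω) (f g h : Fin (7 + 1) → ℂ) (u v w : Ω) : ℂ :=
  ∑ x, f (X.idx u x) * g (X.idx v x) * h (X.idx w x)

theorem tripleSum_swap (f g h : Fin (7 + 1) → ℂ) (u v w : Ω) :
    X.tripleSum f g h u v w = X.tripleSum g f h v u w :=
  Finset.sum_congr rfl fun _ _ => by ring

theorem tripleSum_swap' (f g h : Fin (7 + 1) → ℂ) (u v w : Ω) :
    X.tripleSum f g h u v w = X.tripleSum f h g u w v :=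
  Finset.sum_congr rfl fun _ _ => by ring

theorem tripleSum_rotate (f g h : Fin (7 + 1) → ℂ) (u v w : Ω) :
    X.tripleSum f g h u v w = X.tripleSum h f g w u v :=
  Finset.sum_congr rfl fun _ _ => by ring

theorem tripleSum_sum {ι : Type*} (s : Finset ι) (c : ι → ℂ) (F : ι → Fin (7 + 1) → ℂ)
    (g h : Fin (7 + 1) → ℂ) (u v w : Ω) :
    X.tripleSum (∑ a ∈ s, c a • F a) g h u v w = ∑ a ∈ s, c a * X.tripleSum (F a) g h u v w := by
  simp only [tripleSum, Finset.sum_apply, Pi.smul_apply, smul_eq_mul, Finset.mul_sum,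
    Finset.sum_mul]
  rw [Finset.sum_comm]
  simp only [mul_assoc]

theorem phasePow_shift (hX : X.HasEigenmatrix hoggarEigenmatrix) (s : Bool) (a b : ℕ) (v u x : Ω) :
    thinPow a (X.idx u x) * phasePow s b (X.idx v x) =
      phasePow s b (X.idx v u) * thinPow (a + b) (X.idx u x) := by
  cases s
  · exact thinPow_mul_thickPow_shift hX a b v u x
  · exact thinPow_mul_thinPow_shift hX a b v u x

/-- Only x thinly related to u contribute; shifting both other factors to u leaves a character sum
with exponent a + b + c. -/
theorem tripleSum_thinPow (hX : X.HasEigenmatrix hoggarEigenmatrix) (s t : Bool) (a b c : ℕ)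
    (u v w : Ω) : X.tripleSum (thinPow a) (phasePow s b) (phasePow t c) u v w =
      phasePow s b (X.idx v u) * phasePow t c (X.idx w u) *
        if (a + b + c) % 4 = 0 then 4 else 0 := by
  rw [← sum_thinPow hX (a + b + c) u, Finset.mul_sum]
  refine Finset.sum_congr rfl fun x _ => ?_
  rw [phasePow_shift hX, mul_assoc, phasePow_shift hX, mul_assoc]

theorem tripleSum_thickPow_eq_zero (hX : X.HasEigenmatrix hoggarEigenmatrix) {a b c : ℕ}
    (h : (a + b + c) % 4 ≠ 0) (u v w : Ω) :
    X.tripleSum (thickPow a) (thickPow b) (thickPow c) u v w = 0 := by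
  -- Average over the four vertices y thinly related to x; the exponent 3a ≡ -a undoes the change of
  -- phase. Exchanging the sums then produces a triple sum with a thin factor.
  have h1 : ∀ x, thickPow a (X.idx u x) =
      1 / 4 * ∑ y, thinPow (3 * a) (X.idx x y) * thickPow a (X.idx u y) := by
    intro x
    simp only [thinPow_mul_thickPow_shift hX, ← Finset.mul_sum, sum_thinPow hX]
    rw [if_pos (by omega)]
    ring
  have h2 : ∀ x y, thinPow (3 * a) (X.idx x y) = thinPow a (X.idx y x) := by
    intro x y
    rw [thinPow_swap hX _ y x, star_thinPow]
    exact congrFun (thinPow_congr (by omega)) _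
  have h3 : ∀ y, ∑ x, thinPow a (X.idx y x) * thickPow b (X.idx v x) * thickPow c (X.idx w x) = 0 := by
    intro y
    have h4 := tripleSum_thinPow hX false false a b c y v w
    rw [if_neg h, mul_zero] at h4
    exact h4
  calc X.tripleSum (thickPow a) (thickPow b) (thickPow c) u v w
      = ∑ x, ∑ y, 1 / 4 * thickPow a (X.idx u y) *
          (thinPow a (X.idx y x) * thickPow b (X.idx v x) * thickPow c (X.idx w x)) := by
        refine Finset.sum_congr rfl fun x _ => ?_
        rw [h1 x, Finset.mul_sum, Finset.sum_mul, Finset.sum_mul]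
        refine Finset.sum_congr rfl fun y _ => ?_
        rw [h2]
        ring
    _ = 0 := by
        rw [Finset.sum_comm]
        simp only [← Finset.mul_sum, h3, mul_zero, Finset.sum_const_zero]

/-- Since `thickPow 0` is 1 - `thinPow 0`, the sum is a two-vertex sum minus a thin one; as c ≡ -b,
the former is an entry of the square of the matrix of `thickPow b`. -/
theorem tripleSum_thickPow_zero (hX : X.HasEigenmatrix hoggarEigenmatrix) {b c : ℕ} (hb : b < 4)
    (h : (b + c) % 4 = 0) (u v w : Ω) :
    X.tripleSum (thickPow 0) (thickPow b) (thickPow c) u v w =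
      4 * (63 * thinPow b (X.idx v w) + localEigenvalue b * thickPow b (X.idx v w)) -
        4 * (thickPow b (X.idx v u) * thickPow c (X.idx w u)) := by
  have h1 := tripleSum_thinPow hX false false 0 b c u v w
  rw [if_pos (by omega)] at h1
  simp only [phasePow] at h1
  have h2 : ∀ x, thickPow c (X.idx w x) = thickPow b (X.idx x w) := by
    intro x
    rw [thickPow_swap hX _ x w, star_thickPow]
    exact congrFun (thickPow_congr (by omega)) _
  rw [← sum_thickPow_mul_thickPow hX hb, mul_comm (4 : ℂ) (_ * _), ← h1]
  simp only [tripleSum, thickPow_zero_eq, ← Finset.sum_sub_distrib, ← h2]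
  exact Finset.sum_congr rfl fun x _ => by ring

/-- Of the eight terms in the expanded Krein identity, seven have a thin factor and are known, so
the identity determines the all-thick one. -/
theorem tripleSum_thickPow_one_one_two (hX : X.HasEigenmatrix hoggarEigenmatrix) (u v w : Ω) :
    X.tripleSum (thickPow 1) (thickPow 1) (thickPow 2) u v w =
      252 * (gramPow (X.idx v u) * altPow (X.idx w u) +
        1 / 3 * (thickPow 1 (X.idx u v) * altPow (X.idx w v)) +
        1 / 9 * (thickPow 1 (X.idx u w) * thickPow 1 (X.idx v w))) := by
  have h0 := sum_gramPow_gramPow_altPow hX u v w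
  have h1 := fun s t => tripleSum_thinPow hX s t 1 1 2 u v w
  have h2 := fun t => tripleSum_thinPow hX false t 1 1 2 v u w
  have h3 := tripleSum_thinPow hX false false 2 1 1 w u v
  have hexp : ∑ x, gramPow (X.idx u x) * gramPow (X.idx v x) * altPow (X.idx w x) =
      X.tripleSum (thinPow 1) (phasePow true 1) (phasePow true 2) u v w +
      (-1 / 7) * X.tripleSum (thinPow 1) (phasePow true 1) (phasePow false 2) u v w +
      (1 / 3) * X.tripleSum (thinPow 1) (phasePow false 1) (phasePow true 2) u v w +
      (-1 / 21) * X.tripleSum (thinPow 1) (phasePow false 1) (phasePow false 2) u v w +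
      (1 / 3) * X.tripleSum (thinPow 1) (phasePow false 1) (phasePow true 2) v u w +
      (-1 / 21) * X.tripleSum (thinPow 1) (phasePow false 1) (phasePow false 2) v u w +
      (1 / 9) * X.tripleSum (thinPow 2) (phasePow false 1) (phasePow false 1) w u v +
      (-1 / 63) * X.tripleSum (thickPow 1) (thickPow 1) (thickPow 2) u v w := by
    simp only [tripleSum, Finset.mul_sum, ← Finset.sum_add_distrib]
    refine Finset.sum_congr rfl fun x _ => ?_
    simp only [gramPow, altPow, phasePow, Pi.add_apply, Pi.smul_apply, smul_eq_mul]
    ring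
  rw [hexp, h1, h1, h1, h1, h2, h2, h3] at h0
  simp only [phasePow, Nat.reduceAdd, Nat.reduceMod, if_true] at h0
  simp only [gramPow, altPow, Pi.add_apply, Pi.smul_apply, smul_eq_mul]
  -- The all-thick term has coefficient (1/3)² · (-1/7) = -1/63.
  linear_combination (-63) * h0

theorem star_tripleSum (f g h : Fin (7 + 1) → ℂ) (u v w : Ω) :
    star (X.tripleSum f g h u v w) =
      X.tripleSum (fun j => star (f j)) (fun j => star (g j)) (fun j => star (h j)) u v w := by
  simp only [tripleSum, star_sum, star_mul']

theorem tripleSum_thickPow_three_three_two (u v w : Ω) :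
    X.tripleSum (thickPow 3) (thickPow 3) (thickPow 2) u v w =
      star (X.tripleSum (thickPow 1) (thickPow 1) (thickPow 2) u v w) := by
  rw [star_tripleSum]
  simp only [star_thickPow]
  rw [show thickPow 2 = thickPow (3 * 2) from thickPow_congr rfl]

theorem tripleSum_thickPow_congr (hX : X.HasEigenmatrix hoggarEigenmatrix) {a b c : ℕ}
    (ha : a < 4) (hb : b < 4) (hc : c < 4) {u v w u' v' w' : Ω} (huv : X.idx u v = X.idx u' v')
    (huw : X.idx u w = X.idx u' w') (hvw : X.idx v w = X.idx v' w') :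
    X.tripleSum (thickPow a) (thickPow b) (thickPow c) u v w =
      X.tripleSum (thickPow a) (thickPow b) (thickPow c) u' v' w' := by
  have hvu : X.idx v u = X.idx v' u' := by rw [idx_swap hX u v, idx_swap hX u' v', huv]
  have hwu : X.idx w u = X.idx w' u' := by rw [idx_swap hX u w, idx_swap hX u' w', huw]
  have hwv : X.idx w v = X.idx w' v' := by rw [idx_swap hX v w, idx_swap hX v' w', hvw]
  by_cases h : (a + b + c) % 4 = 0
  swap
  · rw [tripleSum_thickPow_eq_zero hX h, tripleSum_thickPow_eq_zero hX h]
  by_cases ha0 : a = 0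
  · subst ha0
    rw [tripleSum_thickPow_zero hX hb (by omega), tripleSum_thickPow_zero hX hb (by omega), hvw,
      hvu, hwu]
  by_cases hb0 : b = 0
  · subst hb0
    rw [tripleSum_swap, tripleSum_thickPow_zero hX ha (by omega), tripleSum_swap,
      tripleSum_thickPow_zero hX ha (by omega), huw, huv, hwv]
  by_cases hc0 : c = 0
  · subst hc0
    rw [tripleSum_rotate, tripleSum_thickPow_zero hX ha (by omega), tripleSum_rotate,
      tripleSum_thickPow_zero hX ha (by omega), huw, huv, hvw]
  -- The total is 4 or 8, so only arrangements of (1,1,2) and (3,3,2) survive.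
  have hcases : ∀ a < 4, ∀ b < 4, ∀ c < 4, a ≠ 0 → b ≠ 0 → c ≠ 0 → (a + b + c) % 4 = 0 →
      (a = 1 ∧ b = 1 ∧ c = 2) ∨ (a = 1 ∧ b = 2 ∧ c = 1) ∨ (a = 2 ∧ b = 1 ∧ c = 1) ∨
      (a = 3 ∧ b = 3 ∧ c = 2) ∨ (a = 3 ∧ b = 2 ∧ c = 3) ∨ (a = 2 ∧ b = 3 ∧ c = 3) := by
    intro a ha b hb c hc ha0 hb0 hc0 h
    interval_cases a <;> interval_cases b <;> interval_cases c <;> simp_all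
  rcases hcases a ha b hb c hc ha0 hb0 hc0 h with ⟨rfl, rfl, rfl⟩ | ⟨rfl, rfl, rfl⟩ |
    ⟨rfl, rfl, rfl⟩ | ⟨rfl, rfl, rfl⟩ | ⟨rfl, rfl, rfl⟩ | ⟨rfl, rfl, rfl⟩
  · simp only [tripleSum_thickPow_one_one_two hX, huv, huw, hvw, hvu, hwu, hwv]
  · simp only [tripleSum_swap' (thickPow 1) (thickPow 2), tripleSum_thickPow_one_one_two hX,
      huv, huw, hvw, hvu, hwu, hwv]
  · have hrot : ∀ u v w : Ω, X.tripleSum (thickPow 2) (thickPow 1) (thickPow 1) u v w =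
        X.tripleSum (thickPow 1) (thickPow 1) (thickPow 2) v w u :=
      fun u v w => (tripleSum_rotate _ _ _ v w u).symm
    simp only [hrot, tripleSum_thickPow_one_one_two hX, huv, huw, hvw, hvu, hwu, hwv]
  · simp only [tripleSum_thickPow_three_three_two, tripleSum_thickPow_one_one_two hX, huv, huw,
      hvw, hvu, hwu, hwv]
  · simp only [tripleSum_swap' (thickPow 3) (thickPow 2), tripleSum_thickPow_three_three_two,
      tripleSum_thickPow_one_one_two hX, huv, huw, hvw, hvu, hwu, hwv]
  · have hrot : ∀ u v w : Ω, X.tripleSum (thickPow 2) (thickPow 3) (thickPow 3) u v w =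
        X.tripleSum (thickPow 3) (thickPow 3) (thickPow 2) v w u :=
      fun u v w => (tripleSum_rotate _ _ _ v w u).symm
    simp only [hrot, tripleSum_thickPow_three_three_two, tripleSum_thickPow_one_one_two hX, huv, huw,
      hvw, hvu, hwu, hwv]

theorem tripleSum_phasePow_congr (hX : X.HasEigenmatrix hoggarEigenmatrix) (r s t : Bool)
    {a b c : ℕ} (ha : a < 4) (hb : b < 4) (hc : c < 4) {u v w u' v' w' : Ω}
    (huv : X.idx u v = X.idx u' v') (huw : X.idx u w = X.idx u' w')
    (hvw : X.idx v w = X.idx v' w') :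
    X.tripleSum (phasePow r a) (phasePow s b) (phasePow t c) u v w =
      X.tripleSum (phasePow r a) (phasePow s b) (phasePow t c) u' v' w' := by
  have hvu : X.idx v u = X.idx v' u' := by rw [idx_swap hX u v, idx_swap hX u' v', huv]
  have hwu : X.idx w u = X.idx w' u' := by rw [idx_swap hX u w, idx_swap hX u' w', huw]
  have hwv : X.idx w v = X.idx w' v' := by rw [idx_swap hX v w, idx_swap hX v' w', hvw]
  cases r
  · cases s
    · cases t
      · exact tripleSum_thickPow_congr hX ha hb hc huv huw hvw
      · rw [tripleSum_rotate, tripleSum_rotate (phasePow false a)]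
        simp only [phasePow.eq_1]
        rw [tripleSum_thinPow hX, tripleSum_thinPow hX, huw, hvw]
    · rw [tripleSum_swap, tripleSum_swap (phasePow false a)]
      simp only [phasePow.eq_1]
      rw [tripleSum_thinPow hX, tripleSum_thinPow hX, huv, hwv]
  · simp only [phasePow.eq_1]
    rw [tripleSum_thinPow hX, tripleSum_thinPow hX, hvu, hwu]

theorem tripleNumber_eq_tripleSum (X : AssociationScheme 7 Ω) (u v w : Ω)
    (i j k : Fin (7 + 1)) : (X.tripleNumber u v w i j k : ℂ) =
      X.tripleSum (Pi.single i 1) (Pi.single j 1) (Pi.single k 1) u v w := by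
  classical
  simp only [tripleNumber, tripleSum, rel_iff_idx, Pi.single_apply, ← ite_and, mul_ite, mul_one, mul_zero]
  rw [Finset.sum_boole, Set.ncard_eq_toFinset_card']
  congr 2
  ext z
  simp
  tauto

theorem triplyRegular_of_hasEigenmatrix (hX : X.HasEigenmatrix hoggarEigenmatrix) :
    X.TriplyRegular := by
  intro U V W u v w u' v' w' hU hV hW hU' hV' hW' i j k
  rw [rel_iff_idx] at hU hV hW hU' hV' hW'
  have h : (X.tripleNumber u v w i j k : ℂ) = X.tripleNumber u' v' w' i j k := by
    rw [tripleNumber_eq_tripleSum, tripleNumber_eq_tripleSum]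
    -- Fourier inversion in each of the three slots.
    have hexp : ∀ u v w, X.tripleSum (Pi.single i 1) (Pi.single j 1) (Pi.single k 1) u v w =
        ∑ a ∈ Finset.range 4, ∑ b ∈ Finset.range 4, ∑ c ∈ Finset.range 4,
          ((1 / 4 : ℂ) * star (hoggarPhase i) ^ a) * ((1 / 4 : ℂ) * star (hoggarPhase j) ^ b) *
            ((1 / 4 : ℂ) * star (hoggarPhase k) ^ c) *
          X.tripleSum (phasePow (decide (i.val < 4)) a) (phasePow (decide (j.val < 4)) b)
            (phasePow (decide (k.val < 4)) c) u v w := by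
      intro u v w
      rw [single_eq_sum_phasePow i, tripleSum_sum]
      refine Finset.sum_congr rfl fun a _ => ?_
      rw [tripleSum_swap, single_eq_sum_phasePow j, tripleSum_sum, Finset.mul_sum]
      refine Finset.sum_congr rfl fun b _ => ?_
      rw [tripleSum_rotate, single_eq_sum_phasePow k, tripleSum_sum, Finset.mul_sum,
        Finset.mul_sum]
      refine Finset.sum_congr rfl fun c _ => ?_
      rw [← tripleSum_rotate, tripleSum_swap]
      ring
    rw [hexp, hexp]
    refine Finset.sum_congr rfl fun a ha => Finset.sum_congr rfl fun b hb =>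
      Finset.sum_congr rfl fun c hc => ?_
    rw [tripleSum_phasePow_congr hX _ _ _ (Finset.mem_range.1 ha) (Finset.mem_range.1 hb)
      (Finset.mem_range.1 hc) (hW.trans hW'.symm) (hV.trans hV'.symm) (hU.trans hU'.symm)]
  exact_mod_cast h

end Hoggar

/-! ### Multiplication of phase matrices on a thick neighbourhood -/

/-- `e` is an injective parametrization of the neighbourhood `R_i(z)`. -/
structure IsNbhdEmbedding {d : ℕ} {Ω S : Type*} [Fintype Ω] (X : AssociationScheme d Ω)
    (i : Fin (d + 1)) (z : Ω) (e : S → Ω) : Prop where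
  injective : Function.Injective e
  idx_eq : ∀ s, X.idx z (e s) = i
  exists_eq : ∀ y, X.idx z y = i → ∃ s, e s = y

section Local

variable {Ω S : Type*} [Fintype Ω] {X : AssociationScheme 7 Ω} {i : Fin (7 + 1)} {z : Ω}
  {e : S → Ω}

theorem IsNbhdEmbedding.sum_eq [Fintype S] (he : X.IsNbhdEmbedding i z e) (F : Ω → ℂ) :
    ∑ s, F (e s) = ∑ y, (Pi.single i 1 : Fin (7 + 1) → ℂ) (X.idx z y) * F y := by
  classical
  rw [← Finset.sum_image (s := univ) (g := e) (f := F) fun s _ t _ h => he.injective h]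
  simp only [Pi.single_apply, ite_mul, one_mul, zero_mul]
  rw [← Finset.sum_filter]
  refine Finset.sum_congr ?_ fun _ _ => rfl
  ext y
  simp only [mem_image, mem_univ, true_and, mem_filter]
  exact ⟨fun ⟨s, hs⟩ => hs ▸ he.idx_eq s, he.exists_eq y⟩

/-- The matrix of phase powers, off the diagonal, on a neighbourhood. -/
noncomputable def localPow (X : AssociationScheme 7 Ω) (e : S → Ω) (a : ℕ) : Matrix S S ℂ :=
  Matrix.of fun x y => thickPow a (X.idx (e x) (e y))

theorem localPow_apply (a : ℕ) (x y : S) : X.localPow e a x y = thickPow a (X.idx (e x) (e y)) :=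
  rfl

theorem localPow_conjTranspose (hX : X.HasEigenmatrix hoggarEigenmatrix) (a : ℕ) :
    (X.localPow e a)ᴴ = X.localPow e a := by
  ext x y
  simp only [conjTranspose_apply, localPow_apply]
  exact (thickPow_swap hX a (e y) (e x)).symm

theorem localPow_transpose (hX : X.HasEigenmatrix hoggarEigenmatrix) (a : ℕ) :
    (X.localPow e a)ᵀ = X.localPow e (3 * a) := by
  ext x y
  simp only [transpose_apply, localPow_apply]
  rw [thickPow_swap hX a (e x) (e y), star_thickPow]

theorem localPow_congr {a b : ℕ} (h : a % 4 = b % 4) : X.localPow e a = X.localPow e b := by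
  simp only [localPow, thickPow_congr h]

/-- Expanding the indicator of R_i in phase powers turns the entry into triple sums with third
vertex z. All vanish except the one whose exponent c balances a + 3b mod 4; the factor 3 in 3b comes
from transposing. -/
theorem localPow_mul_apply [Fintype S] (hX : X.HasEigenmatrix hoggarEigenmatrix)
    (he : X.IsNbhdEmbedding i z e) (hi : ¬ i.val < 4) {a b c : ℕ} (hc : (c + a + 3 * b) % 4 = 0)
    (hc4 : c < 4) (x w : S) : (X.localPow e a * X.localPow e b) x w =
      1 / 4 * hoggarPhase i ^ (3 * c) *
        X.tripleSum (thickPow c) (thickPow a) (thickPow (3 * b)) z (e x) (e w) := by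
  have h1 : (X.localPow e a * X.localPow e b) x w =
      X.tripleSum (Pi.single i 1) (thickPow a) (thickPow (3 * b)) z (e x) (e w) := by
    simp only [Matrix.mul_apply, localPow_apply]
    rw [he.sum_eq fun y => thickPow a (X.idx (e x) y) * thickPow b (X.idx y (e w))]
    refine Finset.sum_congr rfl fun y _ => ?_
    rw [thickPow_swap hX b (e w) y, star_thickPow, mul_assoc]
  rw [h1, single_eq_sum_phasePow, tripleSum_sum, decide_eq_false hi, pow_mul, ← star_hoggarPhase]
  refine Finset.sum_eq_single_of_mem c (Finset.mem_range.2 hc4) fun c' hc' hne => ?_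
  have hc4' := Finset.mem_range.1 hc'
  rw [phasePow, tripleSum_thickPow_eq_zero hX (by omega), mul_zero]

/-- A nontrivial thin relation changes the phase seen from z, whereas it is the same at every point
of R_i(z). -/
theorem IsNbhdEmbedding.idx_eq_zero_of_lt (hX : X.HasEigenmatrix hoggarEigenmatrix)
    (he : X.IsNbhdEmbedding i z e) {x w : S} (h : (X.idx (e x) (e w)).val < 4) :
    X.idx (e x) (e w) = 0 := by
  have h1 := idx_eq_shift hX (v := z) h
  rw [he.idx_eq, he.idx_eq] at h1
  have h3 := congrArg Fin.val h1
  simp only [hoggarShift] at h3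
  ext
  rw [Fin.val_zero]
  omega

theorem IsNbhdEmbedding.thinPow_apply [DecidableEq S] (hX : X.HasEigenmatrix hoggarEigenmatrix)
    (he : X.IsNbhdEmbedding i z e) (a : ℕ) (x w : S) :
    thinPow a (X.idx (e x) (e w)) = (1 : Matrix S S ℂ) x w := by
  rw [Matrix.one_apply]
  by_cases h : (X.idx (e x) (e w)).val < 4
  · have h2 := he.idx_eq_zero_of_lt hX h
    rw [if_pos (he.injective (X.idx_eq_zero.1 h2)), h2]
    simp [thinPow, hoggarPhase]
  · have h1 : x ≠ w := by
      rintro rfl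
      rw [X.idx_eq_zero.2 rfl] at h
      simp at h
    simp [thinPow, h, h1]

theorem IsNbhdEmbedding.localPow_zero_apply [DecidableEq S]
    (hX : X.HasEigenmatrix hoggarEigenmatrix) (he : X.IsNbhdEmbedding i z e) (x w : S) :
    X.localPow e 0 x w = 1 - (1 : Matrix S S ℂ) x w := by
  rw [localPow_apply, thickPow_zero_eq, he.thinPow_apply hX]

theorem IsNbhdEmbedding.thickPow_left (he : X.IsNbhdEmbedding i z e) (hi : ¬ i.val < 4) (a : ℕ)
    (x : S) : thickPow a (X.idx z (e x)) = hoggarPhase i ^ a := by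
  rw [he.idx_eq, thickPow, if_neg hi]

theorem IsNbhdEmbedding.thickPow_right (hX : X.HasEigenmatrix hoggarEigenmatrix)
    (he : X.IsNbhdEmbedding i z e) (hi : ¬ i.val < 4) (a : ℕ) (x : S) :
    thickPow a (X.idx (e x) z) = hoggarPhase i ^ (3 * a) := by
  rw [thickPow_swap hX a z (e x), he.thickPow_left hi, star_pow, star_hoggarPhase, pow_mul]

theorem IsNbhdEmbedding.thinPow_left (he : X.IsNbhdEmbedding i z e) (hi : ¬ i.val < 4) (a : ℕ)
    (x : S) : thinPow a (X.idx z (e x)) = 0 := by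
  rw [he.idx_eq, thinPow, if_neg hi]

theorem IsNbhdEmbedding.thinPow_right (hX : X.HasEigenmatrix hoggarEigenmatrix)
    (he : X.IsNbhdEmbedding i z e) (hi : ¬ i.val < 4) (a : ℕ) (x : S) :
    thinPow a (X.idx (e x) z) = 0 := by
  rw [thinPow_swap hX a z (e x), he.thinPow_left hi, star_zero]

variable [Fintype S] [DecidableEq S]

theorem localPow_mul_self (hX : X.HasEigenmatrix hoggarEigenmatrix)
    (he : X.IsNbhdEmbedding i z e) (hi : ¬ i.val < 4) {a : ℕ} (ha : a < 4) :
    X.localPow e a * X.localPow e a =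
      (62 : ℂ) • (1 : Matrix S S ℂ) + localEigenvalue a • X.localPow e a - X.localPow e 0 := by
  ext x w
  have hzero : thickPow 0 (X.idx (e x) (e w)) = 1 - (1 : Matrix S S ℂ) x w :=
    he.localPow_zero_apply hX x w
  have hp := hoggarPhase_pow_four i
  have hp' : hoggarPhase i ^ (3 * a) * hoggarPhase i ^ (3 * (3 * a)) = 1 := by
    rw [← pow_add, show 3 * a + 3 * (3 * a) = 4 * (3 * a) by ring, pow_mul, hp, one_pow]
  rw [localPow_mul_apply hX he hi (c := 0) (by omega) (by norm_num),
    tripleSum_thickPow_zero hX ha (by omega)]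
  simp only [he.thickPow_right hX hi, he.thinPow_apply hX, Matrix.add_apply,
    Matrix.sub_apply, Matrix.smul_apply, smul_eq_mul, hzero, localPow_apply, hp']
  ring

/-- As 1 + `localPow e 0` is the all-ones matrix, this amounts to constant column sums
`localEigenvalue b`. -/
theorem localPow_zero_mul (hX : X.HasEigenmatrix hoggarEigenmatrix)
    (he : X.IsNbhdEmbedding i z e) (hi : ¬ i.val < 4) {b : ℕ} (hb : b < 4) :
    X.localPow e 0 * X.localPow e b =
      localEigenvalue b • (1 + X.localPow e 0) - X.localPow e b := by
  ext x w
  have hzero : thickPow 0 (X.idx (e x) (e w)) = 1 - (1 : Matrix S S ℂ) x w :=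
    he.localPow_zero_apply hX x w
  have hp := hoggarPhase_pow_four i
  have hp' : hoggarPhase i ^ (3 * b) * hoggarPhase i ^ b = 1 := by
    rw [← pow_add, show 3 * b + b = 4 * b by ring, pow_mul, hp, one_pow]
  have h1 : thickPow (3 * b) (X.idx (e w) (e x)) = thickPow b (X.idx (e x) (e w)) := by
    rw [thickPow_swap hX _ (e x) (e w), star_thickPow]
    exact congrFun (thickPow_congr (by omega)) _
  rw [localPow_mul_apply hX he hi (c := b) (by omega) hb, tripleSum_swap,
    tripleSum_thickPow_zero hX hb (by omega)]
  simp only [he.thickPow_left hi, he.thinPow_left hi, Matrix.add_apply,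
    Matrix.sub_apply, Matrix.smul_apply, smul_eq_mul, hzero, localPow_apply, h1]
  linear_combination (localEigenvalue b - thickPow b (X.idx (e x) (e w))) * hp'

theorem localPow_mul_zero (hX : X.HasEigenmatrix hoggarEigenmatrix)
    (he : X.IsNbhdEmbedding i z e) (hi : ¬ i.val < 4) {b : ℕ} (hb : b < 4) :
    X.localPow e b * X.localPow e 0 =
      localEigenvalue b • (1 + X.localPow e 0) - X.localPow e b := by
  have h := congrArg conjTranspose (localPow_zero_mul hX he hi hb)
  have hl : star (localEigenvalue b) = localEigenvalue b := by
    unfold localEigenvalue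
    split <;> simp
  simpa only [conjTranspose_mul, conjTranspose_sub, conjTranspose_smul, conjTranspose_add,
    conjTranspose_one, localPow_conjTranspose hX, hl] using h

/-- The balancing exponent is c = 1, so the entry is a (1,1,2) triple sum: the Krein condition
enters here. -/
theorem localPow_one_mul_two (hX : X.HasEigenmatrix hoggarEigenmatrix)
    (he : X.IsNbhdEmbedding i z e) (hi : ¬ i.val < 4) :
    X.localPow e 1 * X.localPow e 2 = (18 : ℂ) • (1 : Matrix S S ℂ) - (3 : ℂ) • X.localPow e 0 -
      (3 : ℂ) • X.localPow e 2 + (7 : ℂ) • X.localPow e 1 := by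
  ext x w
  have hzero : thickPow 0 (X.idx (e x) (e w)) = 1 - (1 : Matrix S S ℂ) x w :=
    he.localPow_zero_apply hX x w
  have hp := hoggarPhase_pow_four i
  have h1 : thickPow 2 (X.idx (e w) (e x)) = thickPow 2 (X.idx (e x) (e w)) := by
    rw [thickPow_swap hX _ (e x) (e w), star_thickPow]
    exact congrFun (thickPow_congr (by norm_num)) _
  have hone : (1 : Matrix S S ℂ) w x = (1 : Matrix S S ℂ) x w := by
    simp only [Matrix.one_apply, eq_comm]
  rw [localPow_mul_apply hX he hi (c := 1) (by norm_num) (by norm_num),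
    show thickPow (3 * 2) = thickPow 2 from thickPow_congr rfl, tripleSum_thickPow_one_one_two hX]
  simp only [gramPow, altPow, Pi.add_apply, Pi.smul_apply, he.thickPow_left hi,
    he.thickPow_right hX hi, he.thinPow_right hX hi, he.thinPow_apply hX, Matrix.add_apply,
    Matrix.sub_apply, Matrix.smul_apply, smul_eq_mul, hzero, localPow_apply, h1, hone]
  -- The phase of i occurs only in powers divisible by 4; these multiples of φ⁴ = 1 remove them.
  linear_combination (-3 * (hoggarPhase i ^ 8 + hoggarPhase i ^ 4 + 1) +
    21 * (1 : Matrix S S ℂ) x w - 3 * thickPow 2 (X.idx (e x) (e w)) +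
    7 * thickPow 1 (X.idx (e x) (e w))) * hp

theorem localPow_one_mul_three (hX : X.HasEigenmatrix hoggarEigenmatrix)
    (he : X.IsNbhdEmbedding i z e) (hi : ¬ i.val < 4) :
    X.localPow e 1 * X.localPow e 3 = (-2 : ℂ) • (1 : Matrix S S ℂ) + (7 : ℂ) • X.localPow e 0 -
      (3 : ℂ) • X.localPow e 1 - (3 : ℂ) • X.localPow e 3 := by
  ext x w
  have hzero : thickPow 0 (X.idx (e x) (e w)) = 1 - (1 : Matrix S S ℂ) x w :=
    he.localPow_zero_apply hX x w
  have hp := hoggarPhase_pow_four i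
  have h1 : thickPow 1 (X.idx (e w) (e x)) = thickPow 3 (X.idx (e x) (e w)) := by
    rw [thickPow_swap hX _ (e x) (e w), star_thickPow]
  have hone : (1 : Matrix S S ℂ) w x = (1 : Matrix S S ℂ) x w := by
    simp only [Matrix.one_apply, eq_comm]
  rw [localPow_mul_apply hX he hi (c := 2) (by norm_num) (by norm_num),
    show thickPow (3 * 3) = thickPow 1 from thickPow_congr rfl, ← tripleSum_rotate,
    tripleSum_thickPow_one_one_two hX]
  simp only [gramPow, altPow, Pi.add_apply, Pi.smul_apply, he.thickPow_left hi,
    he.thickPow_right hX hi, he.thinPow_left hi, he.thinPow_apply hX, Matrix.add_apply,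
    Matrix.sub_apply, Matrix.smul_apply, smul_eq_mul, hzero, localPow_apply, h1, hone]
  linear_combination ((-9 * (1 : Matrix S S ℂ) x w - 3 * thickPow 3 (X.idx (e x) (e w)) -
    3 * thickPow 1 (X.idx (e x) (e w))) * (hoggarPhase i ^ 4 + 1) +
    7 * (hoggarPhase i ^ 8 + hoggarPhase i ^ 4 + 1)) * hp

/-- The remaining products follow by symmetry: each `localPow` is Hermitian and the coefficients are
real, while transposition exchanges the exponents 1 and 3. -/
theorem localPow_two_mul_one (hX : X.HasEigenmatrix hoggarEigenmatrix)
    (he : X.IsNbhdEmbedding i z e) (hi : ¬ i.val < 4) :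
    X.localPow e 2 * X.localPow e 1 = (18 : ℂ) • (1 : Matrix S S ℂ) - (3 : ℂ) • X.localPow e 0 -
      (3 : ℂ) • X.localPow e 2 + (7 : ℂ) • X.localPow e 1 := by
  have h := congrArg conjTranspose (localPow_one_mul_two hX he hi)
  simpa [localPow_conjTranspose hX] using h

theorem localPow_three_mul_one (hX : X.HasEigenmatrix hoggarEigenmatrix)
    (he : X.IsNbhdEmbedding i z e) (hi : ¬ i.val < 4) :
    X.localPow e 3 * X.localPow e 1 = (-2 : ℂ) • (1 : Matrix S S ℂ) + (7 : ℂ) • X.localPow e 0 -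
      (3 : ℂ) • X.localPow e 1 - (3 : ℂ) • X.localPow e 3 := by
  have h := congrArg conjTranspose (localPow_one_mul_three hX he hi)
  simpa [localPow_conjTranspose hX] using h

theorem localPow_three_mul_two (hX : X.HasEigenmatrix hoggarEigenmatrix)
    (he : X.IsNbhdEmbedding i z e) (hi : ¬ i.val < 4) :
    X.localPow e 3 * X.localPow e 2 = (18 : ℂ) • (1 : Matrix S S ℂ) - (3 : ℂ) • X.localPow e 0 -
      (3 : ℂ) • X.localPow e 2 + (7 : ℂ) • X.localPow e 3 := by
  have h := congrArg transpose (localPow_two_mul_one hX he hi)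
  simpa [localPow_transpose hX, localPow_congr (show 6 % 4 = 2 % 4 by norm_num)] using h

theorem localPow_two_mul_three (hX : X.HasEigenmatrix hoggarEigenmatrix)
    (he : X.IsNbhdEmbedding i z e) (hi : ¬ i.val < 4) :
    X.localPow e 2 * X.localPow e 3 = (18 : ℂ) • (1 : Matrix S S ℂ) - (3 : ℂ) • X.localPow e 0 -
      (3 : ℂ) • X.localPow e 2 + (7 : ℂ) • X.localPow e 3 := by
  have h := congrArg conjTranspose (localPow_three_mul_two hX he hi)
  simpa [localPow_conjTranspose hX] using h

end Local

end AssociationScheme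

/-! ### Idempotents and construction of the local scheme -/

/-- The numbering of the relations of the local schemes. -/
def localIdx (j : Fin (4 + 1)) : Fin (7 + 1) :=
  if j = 0 then 0 else if j = 1 then 6 else if j = 2 then 5 else if j = 3 then 4 else 7

theorem localIdx_injective : Function.Injective localIdx := by decide

/-- These are the only relations that can occur inside a neighbourhood. The order 0, 6, 5, 4, 7
matches the valencies 1, 6, 16, 24, 16. -/
theorem exists_localIdx_eq : ∀ k : Fin (7 + 1), k = 0 ∨ ¬ k.val < 4 → ∃ j, localIdx j = k := by
  decide

namespace AssociationScheme

section Local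

variable {Ω S : Type*} [Fintype Ω] {X : AssociationScheme 7 Ω} {i : Fin (7 + 1)} {z : Ω}
  {e : S → Ω}

/-- The adjacency matrices of the local schemes. -/
noncomputable def localAdj (X : AssociationScheme 7 Ω) (e : S → Ω) (j : Fin (4 + 1)) :
    Matrix S S ℂ :=
  Matrix.of fun x y => if X.idx (e x) (e y) = localIdx j then 1 else 0

theorem localPow_eq_sum (a : ℕ) :
    X.localPow e a = ∑ j ∈ (univ : Finset (Fin (4 + 1))).erase 0,
      thickPow a (localIdx j) • X.localAdj e j := by
  ext x y
  simp only [localPow_apply, Matrix.sum_apply, Matrix.smul_apply, localAdj, of_apply, smul_eq_mul,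
    mul_ite, mul_one, mul_zero]
  have hthick : ∀ j, j ≠ 0 → ¬ (localIdx j).val < 4 := by decide
  by_cases h : (X.idx (e x) (e y)).val < 4
  · rw [thickPow, if_pos h]
    refine (Finset.sum_eq_zero fun j hj => if_neg fun h1 => ?_).symm
    exact hthick j (Finset.ne_of_mem_erase hj) (h1 ▸ h)
  · obtain ⟨j, hj⟩ := exists_localIdx_eq _ (Or.inr h)
    have hj0 : j ≠ 0 := by
      rintro rfl
      rw [← hj] at h
      exact h (by decide)
    rw [Finset.sum_eq_single_of_mem j (Finset.mem_erase.2 ⟨hj0, mem_univ j⟩), if_pos hj.symm, hj]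
    intro k _ hk
    exact if_neg fun h1 => hk (localIdx_injective (h1.symm.trans hj.symm))

variable [DecidableEq S]

/-- The primitive idempotents of the local schemes. -/
noncomputable def localIdem (X : AssociationScheme 7 Ω) (e : S → Ω) (k : Fin (4 + 1)) :
    Matrix S S ℂ :=
  -- Each `localPow` has zero diagonal, so on a thick neighbourhood (63 points) the coefficient of
  -- the identity is rank/63, with ranks 1, 21, 27, 7, 7.
  if k = 0 then (1 / 63 : ℂ) • (1 : Matrix S S ℂ) + (1 / 63 : ℂ) • X.localPow e 0
  else if k = 1 then (1 / 3 : ℂ) • (1 : Matrix S S ℂ) + (1 / 48 : ℂ) • X.localPow e 0 +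
    (-1 / 24 : ℂ) • X.localPow e 1 + (1 / 16 : ℂ) • X.localPow e 2 + (-1 / 24 : ℂ) • X.localPow e 3
  else if k = 2 then (3 / 7 : ℂ) • (1 : Matrix S S ℂ) + (-1 / 112 : ℂ) • X.localPow e 0 +
    (-1 / 16 : ℂ) • X.localPow e 2
  else if k = 3 then (1 / 9 : ℂ) • (1 : Matrix S S ℂ) + (-1 / 72 : ℂ) • X.localPow e 0 +
    (1 / 24 : ℂ) • X.localPow e 3
  else (1 / 9 : ℂ) • (1 : Matrix S S ℂ) + (-1 / 72 : ℂ) • X.localPow e 0 +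
    (1 / 24 : ℂ) • X.localPow e 1

theorem localIdem_mul_localIdem [Fintype S] (hX : X.HasEigenmatrix hoggarEigenmatrix)
    (he : X.IsNbhdEmbedding i z e) (hi : ¬ i.val < 4) (k l : Fin (4 + 1)) :
    X.localIdem e k * X.localIdem e l = if k = l then X.localIdem e k else 0 := by
  have h00 := localPow_mul_self hX he hi (a := 0) (by norm_num)
  have h11 := localPow_mul_self hX he hi (a := 1) (by norm_num)
  have h22 := localPow_mul_self hX he hi (a := 2) (by norm_num)
  have h33 := localPow_mul_self hX he hi (a := 3) (by norm_num)
  have h01 := localPow_zero_mul hX he hi (b := 1) (by norm_num)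
  have h02 := localPow_zero_mul hX he hi (b := 2) (by norm_num)
  have h03 := localPow_zero_mul hX he hi (b := 3) (by norm_num)
  have h10 := localPow_mul_zero hX he hi (b := 1) (by norm_num)
  have h20 := localPow_mul_zero hX he hi (b := 2) (by norm_num)
  have h30 := localPow_mul_zero hX he hi (b := 3) (by norm_num)
  have h12 := localPow_one_mul_two hX he hi
  have h21 := localPow_two_mul_one hX he hi
  have h13 := localPow_one_mul_three hX he hi
  have h31 := localPow_three_mul_one hX he hi
  have h23 := localPow_two_mul_three hX he hi
  have h32 := localPow_three_mul_two hX he hi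
  simp only [localEigenvalue] at h00 h11 h22 h33 h01 h02 h03 h10 h20 h30
  fin_cases k <;> fin_cases l <;>
    simp only [localIdem, Fin.reduceFinMk, Fin.isValue, Fin.reduceEq, Fin.zero_eta, Fin.mk_one,
      if_true, if_false, add_mul, mul_add, smul_mul_assoc, mul_smul_comm, one_mul, mul_one, h00,
      h11, h22, h33, h01, h02, h03, h10, h20, h30, h12, h21, h13, h31, h23, h32] <;>
    module

theorem localIdem_ne_zero (s : S) (k : Fin (4 + 1)) : X.localIdem e k ≠ 0 := by
  have h0 : ∀ a, X.localPow e a s s = 0 := by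
    intro a
    rw [localPow_apply, X.idx_eq_zero.2 rfl]
    simp [thickPow]
  intro h
  have h1 := congrFun (congrFun h s) s
  revert h1
  unfold localIdem
  split_ifs <;> simp [h0]

theorem IsNbhdEmbedding.localAdj_eq
    (he : X.IsNbhdEmbedding i z e) (j : Fin (4 + 1)) :
    X.localAdj e j = ∑ k, hexFissionEigenmatrix k j • X.localIdem e k := by
  by_cases hj : j = 0
  · subst hj
    have h1 : X.localAdj e 0 = 1 := by
      ext x y
      simp only [localAdj, of_apply, Matrix.one_apply, localIdx, if_true, X.idx_eq_zero,
        he.injective.eq_iff]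
    rw [h1]
    simp [Fin.sum_univ_succ, hexFissionEigenmatrix, localIdem]
    module
  -- Fourier inversion reduces the claim to a linear identity in the matrices `localPow e a`.
  · have h1 : X.localAdj e j = ∑ a ∈ Finset.range 4,
        ((1 / 4 : ℂ) * star (hoggarPhase (localIdx j)) ^ a) • X.localPow e a := by
      ext x y
      have hthick : ¬ (localIdx j).val < 4 := by
        revert j; decide
      have h2 := congrFun (single_eq_sum_phasePow (localIdx j)) (X.idx (e x) (e y))
      rw [decide_eq_false hthick] at h2
      simp only [Pi.single_apply, Finset.sum_apply, Pi.smul_apply, phasePow] at h2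
      simp only [localAdj, of_apply, h2, Matrix.sum_apply, Matrix.smul_apply, localPow_apply]
    rw [h1]
    fin_cases j
    · exact absurd rfl hj
    all_goals
      simp [Fin.sum_univ_succ, hexFissionEigenmatrix, localIdem, Finset.sum_range_succ, localIdx,
        hoggarPhase, Complex.I_pow_three, Odd.neg_pow (show Odd 3 by decide)]
      module

end Local

section Local

variable {Ω S : Type*} [Fintype Ω] {X : AssociationScheme 7 Ω} {i : Fin (7 + 1)} {z : Ω}
  {e : S → Ω}

/-- Membership in the neighbourhood is a condition on the relation to z, so triple regularity
applies to local intersection numbers. -/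
theorem ncard_local_eq_tripleNumber (hX : X.HasEigenmatrix hoggarEigenmatrix)
    (he : X.IsNbhdEmbedding i z e) (j k : Fin (4 + 1)) (x y : S) :
    {w | X.idx (e x) (e w) = localIdx j ∧ X.idx (e w) (e y) = localIdx k}.ncard =
      X.tripleNumber z (e x) (e y) i (localIdx j) (hoggarInv (localIdx k)) := by
  rw [tripleNumber, ← Set.ncard_image_of_injective _ he.injective]
  have hinv : ∀ k, hoggarInv (hoggarInv k) = k := by decide
  congr 1
  ext w
  simp only [Set.mem_image, Set.mem_ofPred_eq, rel_iff_idx]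
  constructor
  · rintro ⟨s, ⟨h1, h2⟩, rfl⟩
    exact ⟨he.idx_eq s, h1, by rw [idx_swap hX (e s) (e y), h2]⟩
  · rintro ⟨h1, h2, h3⟩
    obtain ⟨s, rfl⟩ := he.exists_eq w h1
    exact ⟨s, ⟨h2, by rw [idx_swap hX (e y) (e s), h3, hinv]⟩, rfl⟩

theorem ncard_local_congr (hX : X.HasEigenmatrix hoggarEigenmatrix)
    (he : X.IsNbhdEmbedding i z e) (j k : Fin (4 + 1)) {x y x' y' : S}
    (h : X.idx (e x) (e y) = X.idx (e x') (e y')) :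
    {w | X.idx (e x) (e w) = localIdx j ∧ X.idx (e w) (e y) = localIdx k}.ncard =
      {w | X.idx (e x') (e w) = localIdx j ∧ X.idx (e w) (e y') = localIdx k}.ncard := by
  rw [ncard_local_eq_tripleNumber hX he, ncard_local_eq_tripleNumber hX he]
  exact triplyRegular_of_hasEigenmatrix hX (X.idx (e x) (e y)) i i _ _ _ _ _ _
    (X.rel_iff_idx.2 rfl) (X.rel_iff_idx.2 (he.idx_eq y)) (X.rel_iff_idx.2 (he.idx_eq x))
    (X.rel_iff_idx.2 h.symm) (X.rel_iff_idx.2 (he.idx_eq y')) (X.rel_iff_idx.2 (he.idx_eq x')) _ _ _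

variable [Fintype S]

theorem localAdj_mul_localAdj_apply (j k : Fin (4 + 1)) (x y : S) :
    (X.localAdj e j * X.localAdj e k) x y =
      ({w | X.idx (e x) (e w) = localIdx j ∧ X.idx (e w) (e y) = localIdx k}.ncard : ℂ) := by
  classical
  simp only [Matrix.mul_apply, localAdj, of_apply, ← ite_and, ite_mul, one_mul, zero_mul]
  rw [Finset.sum_boole, Set.ncard_eq_toFinset_card']
  congr 2
  ext w
  simp

theorem localAdj_mul_localAdj [DecidableEq S] (hX : X.HasEigenmatrix hoggarEigenmatrix)
    (he : X.IsNbhdEmbedding i z e) (hi : ¬ i.val < 4) (j k : Fin (4 + 1)) :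
    X.localAdj e j * X.localAdj e k =
      ∑ l, (hexFissionEigenmatrix l j * hexFissionEigenmatrix l k) • X.localIdem e l := by
  simp only [he.localAdj_eq, Finset.sum_mul, Finset.mul_sum, smul_mul_assoc, mul_smul_comm,
    localIdem_mul_localIdem hX he hi, smul_smul, smul_ite, smul_zero, Finset.sum_ite_eq',
    Finset.mem_univ, if_true]
  simp only [mul_comm]

theorem localAdj_mul_comm (hX : X.HasEigenmatrix hoggarEigenmatrix)
    (he : X.IsNbhdEmbedding i z e) (hi : ¬ i.val < 4) (j k : Fin (4 + 1)) :
    X.localAdj e j * X.localAdj e k = X.localAdj e k * X.localAdj e j := by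
  classical
  simp only [localAdj_mul_localAdj hX he hi, mul_comm]

/-- An empty relation would have zero adjacency matrix, but its eigenvalue on the nonzero idempotent
`localIdem e 0` is a positive valency. -/
theorem exists_idx_eq_localIdx (hX : X.HasEigenmatrix hoggarEigenmatrix)
    (he : X.IsNbhdEmbedding i z e) (hi : ¬ i.val < 4) (s : S) (j : Fin (4 + 1)) :
    ∃ x y, X.idx (e x) (e y) = localIdx j := by
  classical
  by_contra! h
  have h0 : X.localAdj e j = 0 := by
    ext x y
    simp [localAdj, h x y]
  have h1 : X.localAdj e j * X.localIdem e 0 =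
      hexFissionEigenmatrix 0 j • X.localIdem e 0 := by
    simp only [he.localAdj_eq, Finset.sum_mul, smul_mul_assoc, localIdem_mul_localIdem hX he hi,
      smul_ite, smul_zero]
    rw [Finset.sum_ite_eq' univ (0 : Fin (4 + 1)), if_pos (mem_univ _)]
  rw [h0, zero_mul, eq_comm, smul_eq_zero] at h1
  rcases h1 with h1 | h1
  · revert h1
    fin_cases j <;> simp [hexFissionEigenmatrix]
  · exact localIdem_ne_zero s 0 h1

/-- The scheme induced on a thick neighbourhood. -/
noncomputable def localScheme (hX : X.HasEigenmatrix hoggarEigenmatrix)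
    (he : X.IsNbhdEmbedding i z e) (hi : ¬ i.val < 4) (s : S) : AssociationScheme 4 S where
  rel j x y := X.idx (e x) (e y) = localIdx j
  -- Counted at one chosen pair in relation l; `ncard_local_congr` makes the choice immaterial.
  p j k l := {w | X.idx (e (exists_idx_eq_localIdx hX he hi s l).choose) (e w) = localIdx j ∧
    X.idx (e w) (e (exists_idx_eq_localIdx hX he hi s l).choose_spec.choose) = localIdx k}.ncard
  rel_zero x y := by
    simp only [localIdx, if_true, idx_eq_zero, he.injective.eq_iff]
  rel_nonempty := exists_idx_eq_localIdx hX he hi s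
  rel_partition x y := by
    obtain ⟨j, hj⟩ := exists_localIdx_eq (X.idx (e x) (e y))
      (or_iff_not_imp_right.2 fun h => he.idx_eq_zero_of_lt hX (not_not.1 h))
    exact ⟨j, hj.symm, fun k hk => localIdx_injective (hk.symm.trans hj.symm)⟩
  rel_transpose j := by
    have h : ∀ j, ∃ j', localIdx j' = hoggarInv (localIdx j) := by decide
    have hinj : ∀ j k, hoggarInv j = hoggarInv k ↔ j = k := by decide
    obtain ⟨j', hj'⟩ := h j
    exact ⟨j', fun x y => by rw [hj', idx_swap hX (e y) (e x), hinj]⟩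
  card_eq j k l x y h := ncard_local_congr hX he j k
    (h.trans (exists_idx_eq_localIdx hX he hi s l).choose_spec.choose_spec.symm)
  p_comm j k l := by
    have h := congrFun (congrFun (localAdj_mul_comm hX he hi j k)
      (exists_idx_eq_localIdx hX he hi s l).choose)
      (exists_idx_eq_localIdx hX he hi s l).choose_spec.choose
    simp only [localAdj_mul_localAdj_apply] at h
    exact_mod_cast h

theorem localScheme_adj (hX : X.HasEigenmatrix hoggarEigenmatrix)
    (he : X.IsNbhdEmbedding i z e) (hi : ¬ i.val < 4) (s : S) (j : Fin (4 + 1)) :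
    (localScheme hX he hi s).adj j = X.localAdj e j := by
  ext x y
  simp only [adj, localAdj, of_apply, localScheme]
  congr

theorem localScheme_hasEigenmatrix (hX : X.HasEigenmatrix hoggarEigenmatrix)
    (he : X.IsNbhdEmbedding i z e) (hi : ¬ i.val < 4) (s : S) :
    (localScheme hX he hi s).HasEigenmatrix hexFissionEigenmatrix := by
  classical
  have hadj : ∀ j, X.localAdj e j ∈ (localScheme hX he hi s).boseMesner := fun j =>
    localScheme_adj hX he hi s j ▸ adj_mem_boseMesner _ j
  have hone : (1 : Matrix S S ℂ) ∈ (localScheme hX he hi s).boseMesner := by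
    rw [← adj_zero (localScheme hX he hi s)]
    exact adj_mem_boseMesner _ 0
  have hpow : ∀ a, X.localPow e a ∈ (localScheme hX he hi s).boseMesner := fun a => by
    rw [localPow_eq_sum]
    exact Submodule.sum_mem _ fun j _ => Submodule.smul_mem _ _ (hadj j)
  refine hasEigenmatrix_of_orthogonal _ (X.localIdem e) (fun k => ?_) (localIdem_ne_zero s)
    (localIdem_mul_localIdem hX he hi) fun j => ?_
  · unfold localIdem
    split_ifs <;>
      repeat' first
        | apply Submodule.add_mem
        | exact Submodule.smul_mem _ _ hone
        | exact Submodule.smul_mem _ _ (hpow _)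
  · rw [localScheme_adj, he.localAdj_eq]

end Local

/-! ### Valencies and the neighbourhoods R_i(z) -/

section Nbhd

variable {Ω : Type*} [Fintype Ω] {X : AssociationScheme 7 Ω} {i : Fin (7 + 1)} {z : Ω}

theorem isNbhdEmbedding_val (X : AssociationScheme 7 Ω) (i : Fin (7 + 1)) (z : Ω) :
    X.IsNbhdEmbedding i z (fun s : X.Nbhd i z => s.1) where
  injective := Subtype.val_injective
  idx_eq s := X.rel_iff_idx.1 s.2
  exists_eq y hy := ⟨⟨y, X.rel_iff_idx.2 hy⟩, rfl⟩

theorem ncard_rel (hX : X.HasEigenmatrix hoggarEigenmatrix) (i : Fin (7 + 1)) (z : Ω) :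
    ({x | X.rel i z x}.ncard : ℂ) = hoggarEigenmatrix 0 i := by
  classical
  have h := sum_combo_row hX (Pi.single i 1) z
  rw [Matrix.mulVec_single_one, Matrix.col_apply] at h
  rw [← h]
  simp only [Pi.single_apply, rel_iff_idx]
  rw [Finset.sum_boole, Set.ncard_eq_toFinset_card']
  congr 2
  ext x
  simp

theorem isThin_of_lt_four (hX : X.HasEigenmatrix hoggarEigenmatrix) (hi : i.val < 4) :
    X.IsThin i := by
  intro z
  have h := ncard_rel hX i z
  have h1 : hoggarEigenmatrix 0 i = 1 := by
    fin_cases i <;> simp [hoggarEigenmatrix] at hi ⊢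
  rw [h1] at h
  exact_mod_cast h

theorem nonempty_nbhd (hX : X.HasEigenmatrix hoggarEigenmatrix) (i : Fin (7 + 1)) (z : Ω) :
    Nonempty (X.Nbhd i z) := by
  by_contra h
  have h0 : {x | X.rel i z x} = ∅ := by
    rw [Set.eq_empty_iff_forall_notMem]
    exact fun x hx => h ⟨⟨x, hx⟩⟩
  have h1 := ncard_rel hX i z
  rw [h0, Set.ncard_empty, Nat.cast_zero] at h1
  revert h1
  fin_cases i <;> simp [hoggarEigenmatrix]

theorem isLocalScheme_localScheme (hX : X.HasEigenmatrix hoggarEigenmatrix) (hi : ¬ i.val < 4)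
    (s : X.Nbhd i z) :
    X.IsLocalScheme i z (localScheme hX (X.isNbhdEmbedding_val i z) hi s) := by
  have hrel : ∀ j, (localScheme hX (X.isNbhdEmbedding_val i z) hi s).rel j =
      X.restrict i z (localIdx j) := by
    intro j
    funext x y
    exact propext X.rel_iff_idx.symm
  ext R
  constructor
  · rintro ⟨j, rfl⟩
    exact ⟨rel_nonempty _ j, localIdx j, hrel j⟩
  · rintro ⟨⟨x, y, hxy⟩, k, rfl⟩
    have hk : X.idx x.1 y.1 = k := X.rel_iff_idx.1 hxy
    obtain ⟨j, hj⟩ := exists_localIdx_eq k (or_iff_not_imp_right.2 fun h =>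
      hk ▸ (X.isNbhdEmbedding_val i z).idx_eq_zero_of_lt hX (x := x) (w := y)
        (by rw [hk]; exact not_not.1 h))
    exact ⟨j, by rw [hrel, hj]⟩

end Nbhd

end AssociationScheme

theorem mainTheorem8 {Ω : Type*} [Fintype Ω] (X : AssociationScheme 7 Ω)
    (hX : X.HasEigenmatrix hoggarEigenmatrix) :
    X.TriplyRegular ∧
      ∀ (i : Fin (7 + 1)) (z : Ω), ¬ X.IsThin i →
        (∃ Y : AssociationScheme 4 (X.Nbhd i z), X.IsLocalScheme i z Y) ∧
        ∀ (e : ℕ) (Y : AssociationScheme e (X.Nbhd i z)), X.IsLocalScheme i z Y →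
          e = 4 ∧ ∃ Y' : AssociationScheme 4 (X.Nbhd i z),
            Set.range Y'.rel = Set.range Y.rel ∧ Y'.HasEigenmatrix hexFissionEigenmatrix := by
  refine ⟨AssociationScheme.triplyRegular_of_hasEigenmatrix hX, fun i z hthin => ?_⟩
  have hi : ¬ i.val < 4 := fun h => hthin (AssociationScheme.isThin_of_lt_four hX h)
  obtain ⟨s⟩ := AssociationScheme.nonempty_nbhd hX i z
  have hlocal := AssociationScheme.isLocalScheme_localScheme hX hi s
  refine ⟨⟨_, hlocal⟩, fun e Y hY => ?_⟩
  -- Being a local scheme fixes the set of relations, so any such Y is a renumbering of the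
  -- constructed one.
  have hrange := Eq.trans hlocal (Eq.symm hY)
  exact ⟨AssociationScheme.classes_eq_of_range_rel_eq hrange.symm, _, hrange,
    AssociationScheme.localScheme_hasEigenmatrix hX _ hi s⟩
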